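/- Let $1\le p\le 2$ and let $h(x)=\frac1\pi\int_0^\infty\cos(tx)\,e^{-t^p}\,dt$ be the density of the symmetric $p$-stable distribution. There are constants $c,C>0$ depending only on $p$ such that the following holds for every symmetric $p$-stable random variable $g$ (that is, a real random variable with density $h$), every $1\le q\le p$ and every $0<\varepsilon<\frac12$. Put $H(a)=\mathbb E\,|\sin(ag)|^q$, and, for $a>0$, $$Q=2\int_0^\infty u^q h(u)\,du\quad(\text{if } q<p),\qquad Q_a=2\int_0^{\sqrt\varepsilon/a}u^p h(u)\,du .$$ (a) Threshold: $H(a)\le 1$ for every $a\in\mathbb R$. (b) Bi-Lipschitz for small scales: if $q<p$, then $u^qh(u)$ is integrable on $(0,\infty)$ (so that $Q$ is finite), and whenever $$0<a\le\min\Bigl\{\varepsilon^{\frac12+\frac1{p-q}},\ \sqrt\varepsilon\,\bigl(1+(p-q)\varepsilon^{-(q/2+1)}\bigr)^{-1/(p-q)}\Bigr\}$$ we have $1-C\varepsilon\le \frac{H(a)}{a^qQ}\le 1+C\varepsilon$. If $q=p$ and $0<a\le\sqrt\varepsilon\,e^{-\varepsilon^{-(q/2+1)}}$, then $1-C\varepsilon\le\frac{H(a)}{a^qQ_a}\le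 1+C\varepsilon$. (c) Bi-Lipschitz for intermediate scales: let $0<a<1$. If $q<p$ and $\delta=1-a^{p-q}$, then $$c\,(1+\delta Q)\,a^q\le H(a)\le C\,(1+\delta Q)\,a^q .$$ If $q=p$, then $H(a)\le C\,(1+\ln(1/a))\,a^q$, and if moreover $p<2$, then also $H(a)\ge c\,(1+\ln(1/a))\,a^q$. (d) Lower bound for large scales: $H(a)>\frac18$ for every $a\ge1$. (e) Smoothness: for $0<a\le1$, $\ \dfrac{|H((1+\varepsilon)a)-H(a)|}{H(a)}\le C\varepsilon$. -/

import Mathlib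

open MeasureTheory ProbabilityTheory

/-- The density `h(x) = (1/π) ∫₀^∞ cos(tx) e^{-t^p} dt` of the (standard) symmetric
`p`-stable distribution. -/
noncomputable def stableDensity (p x : ℝ) : ℝ :=
  (1 / Real.pi) * ∫ t in Set.Ioi (0 : ℝ), Real.cos (t * x) * Real.exp (-(t ^ p))

/-- `g` is a symmetric `p`-stable random variable on `(Ω, P)`: it is (a.e.-)measurable and its law
is absolutely continuous with density `stableDensity p`. -/
def IsSymmetricStable {Ω : Type*} [MeasurableSpace Ω] (p : ℝ) (g : Ω → ℝ) (P : Measure Ω) : Prop :=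
  HasLaw g (volume.withDensity fun x => ENNReal.ofReal (stableDensity p x)) P

/-- `H(a) = E |sin(a g)|^q`. -/
noncomputable def sineMoment {Ω : Type*} [MeasurableSpace Ω] (P : Measure Ω) (g : Ω → ℝ)
    (q a : ℝ) : ℝ :=
  ∫ ω, |Real.sin (a * g ω)| ^ q ∂P

/-- `Q = 2 ∫₀^∞ u^q h(u) du`. -/
noncomputable def stableQ (p q : ℝ) : ℝ :=
  2 * ∫ u in Set.Ioi (0 : ℝ), u ^ q * stableDensity p u

/-- `Q_a = 2 ∫₀^{√ε/a} u^p h(u) du`. -/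
noncomputable def truncatedQ (p ε a : ℝ) : ℝ :=
  2 * ∫ u in (0 : ℝ)..(Real.sqrt ε / a), u ^ p * stableDensity p u

/-! Since `h` is even, H(a) = 2∫₀^∞ |sin(au)|^q h(u) du, and everything reduces to the size of `h`:
it is bounded, bounded below near 0, of exact order u^(-p-1) at infinity when p < 2, and Gaussian
when p = 2. `DensityBounds` records these facts, and the real analysis uses nothing else except in
the smoothness estimate at p = 1.

Cut the integral at T. Before T, |sin(au)| is comparable to au, which gives a^q ∫₀^T u^q h; after T
it is at most 1, which gives a mass O(T^(-p)). With T = √ε/a the sine is linear up to a factor 1 -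
O(ε), and the smallness of a makes both the lost mass and the lost moment O(ε) relative to the main
term. With T = 1/a only constants are lost, and the truncated moment has the order of 1 + ∫₁^{1/a}
u^(q-p-1) du, which is 1 + δ/(p-q) for q < p and 1 + ln(1/a) for q = p. Constants stay uniform in q
because, for p < 2, the full moment is itself of order 1/(p-q); for p = 2 the light tail produces no
such factor.

The tail of `h` comes from one integration by parts, which makes x h(x) a multiple of the imaginary
part of the transform of t^(p-1) e^(-t^p). Replacing e^(-t^p) by e^(-t) gives the Gamma transform
Γ(p)(1 - ix)^(-p) exactly, and the error is O(x^(-2)) = o(x^(-p)) for p < 2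
(`tendsto_rpow_mul_stableDensity`).

Fourier inversion gives the total mass of `h` and E cos(2ag), whence the large-scale bound through
sin². Smoothness for p > 1 is a mean value estimate that needs a first moment; for p = 1 the
dilation is moved onto the explicit Cauchy density. Nonnegativity of `h` is deduced from the
existence of a variable with that law, so it stays a hypothesis inside the estimates, after their
constants are chosen. -/

/-! ### One-sided Fourier integrals and integration by parts. -/

/-- The one-sided Fourier integral `∫₀^∞ e^{ixt} f(t) dt`. -/
noncomputable def halfFourier (f : ℝ → ℝ) (x : ℝ) : ℂ :=
  ∫ t in Set.Ioi (0 : ℝ), Complex.exp (Complex.I * x * t) * (f t : ℂ)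

theorem norm_exp_I_mul_mul (x t : ℝ) : ‖Complex.exp (Complex.I * x * t)‖ = 1 := by
  rw [Complex.norm_exp]
  simp

theorem integrableOn_exp_mul {f : ℝ → ℝ} {s : Set ℝ} (hf : IntegrableOn f s) (x : ℝ) :
    IntegrableOn (fun t : ℝ => Complex.exp (Complex.I * x * t) * (f t : ℂ)) s := by
  refine Integrable.bdd_mul (c := 1) hf.ofReal ?_ ?_
  · exact (by fun_prop : Continuous fun t : ℝ => Complex.exp (Complex.I * x * t)).aestronglyMeasurable
  · exact Filter.Eventually.of_forall fun t => (norm_exp_I_mul_mul x t).le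

theorem halfFourier_add {f g : ℝ → ℝ} (hf : IntegrableOn f (Set.Ioi 0))
    (hg : IntegrableOn g (Set.Ioi 0)) (x : ℝ) :
    halfFourier (fun t => f t + g t) x = halfFourier f x + halfFourier g x := by
  unfold halfFourier
  rw [← integral_add (integrableOn_exp_mul hf x) (integrableOn_exp_mul hg x)]
  congr 1; ext t; push_cast; ring

theorem halfFourier_const_mul (c : ℝ) (f : ℝ → ℝ) (x : ℝ) :
    halfFourier (fun t => c * f t) x = c * halfFourier f x := by
  unfold halfFourier
  rw [← integral_const_mul]
  congr 1; ext t; push_cast; ring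

theorem norm_halfFourier_le (f : ℝ → ℝ) (x : ℝ) :
    ‖halfFourier f x‖ ≤ ∫ t in Set.Ioi (0 : ℝ), |f t| := by
  refine (norm_integral_le_integral_norm _).trans (le_of_eq ?_)
  congr 1; ext t
  rw [norm_mul, norm_exp_I_mul_mul, one_mul, Complex.norm_real, Real.norm_eq_abs]

theorem halfFourier_re {f : ℝ → ℝ} (hf : IntegrableOn f (Set.Ioi 0)) (x : ℝ) :
    (halfFourier f x).re = ∫ t in Set.Ioi (0 : ℝ), Real.cos (t * x) * f t := by
  unfold halfFourier
  have := integral_re (𝕜 := ℂ) (integrableOn_exp_mul hf x)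
  simp only [RCLike.re_to_complex] at this
  rw [← this]
  congr 1; ext t
  rw [Complex.re_mul_ofReal]
  congr 1
  rw [Complex.exp_re]
  simp [mul_comm]

/-- Integration by parts for the one-sided Fourier integral. -/
theorem halfFourier_deriv {f f' : ℝ → ℝ} {y : ℝ}
    (hd : ∀ t ∈ Set.Ioi (0 : ℝ), HasDerivAt f (f' t) t)
    (hf : IntegrableOn f (Set.Ioi 0)) (hf' : IntegrableOn f' (Set.Ioi 0))
    (h0 : Filter.Tendsto f (nhdsWithin 0 (Set.Ioi 0)) (nhds y)) (x : ℝ) :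
    halfFourier f' x = -y - Complex.I * x * halfFourier f x := by
  unfold halfFourier
  have hE : ∀ t : ℝ, HasDerivAt (fun t : ℝ => Complex.exp (Complex.I * x * t))
      (Complex.I * x * Complex.exp (Complex.I * x * t)) t := by
    intro t
    have h1 : HasDerivAt (fun t : ℝ => Complex.I * x * (t : ℂ)) (Complex.I * x) t := by
      simpa using (Complex.ofRealCLM.hasDerivAt (x := t)).const_mul (Complex.I * x)
    simpa [mul_comm] using h1.cexp
  have hinf := tendsto_zero_of_hasDerivAt_of_integrableOn_Ioi hd hf' hf
  have key := integral_Ioi_mul_deriv_eq_deriv_mul (A := ℂ) (a := 0) (a' := (y : ℂ)) (b' := 0)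
    (u := fun t : ℝ => Complex.exp (Complex.I * x * t))
    (u' := fun t : ℝ => Complex.I * x * Complex.exp (Complex.I * x * t))
    (v := fun t => (f t : ℂ)) (v' := fun t => (f' t : ℂ))
    (fun t _ => hE t) (fun t ht => (hd t ht).ofReal_comp)
    (integrableOn_exp_mul hf' x) ?_ ?_ ?_
  · rw [key, ← integral_const_mul]
    simp only [mul_assoc]
    ring
  · have := (integrableOn_exp_mul hf x).const_mul (Complex.I * x)
    refine this.congr (Filter.Eventually.of_forall fun t => ?_)
    simp [mul_assoc]
  · have hc : Filter.Tendsto (fun t : ℝ => Complex.exp (Complex.I * x * t))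
        (nhdsWithin 0 (Set.Ioi 0)) (nhds 1) := by
      have : Continuous fun t : ℝ => Complex.exp (Complex.I * x * t) := by fun_prop
      have := this.tendsto 0
      simp only [Complex.ofReal_zero, mul_zero, Complex.exp_zero] at this
      exact this.mono_left nhdsWithin_le_nhds
    have h2 : Filter.Tendsto (fun t => (f t : ℂ)) (nhdsWithin 0 (Set.Ioi 0)) (nhds (y : ℂ)) :=
      (Complex.continuous_ofReal.tendsto y).comp h0
    have h3 := hc.mul h2
    rw [one_mul] at h3
    exact h3
  · rw [tendsto_zero_iff_norm_tendsto_zero]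
    have : (fun t => ‖((fun t : ℝ => Complex.exp (Complex.I * x * t)) * fun t => (f t : ℂ)) t‖)
        = fun t => ‖f t‖ := by
      ext t
      rw [Pi.mul_apply, norm_mul, norm_exp_I_mul_mul, one_mul, Complex.norm_real]
    rw [this]
    simpa using hinf.norm

/-! ### Integrands t^s e^(-t^r) and the Gamma transform. -/

theorem hasDerivAt_rpow_mul_exp_neg_rpow (s r : ℝ) {t : ℝ} (ht : 0 < t) :
    HasDerivAt (fun t : ℝ => t ^ s * Real.exp (-(t ^ r)))
      (s * (t ^ (s - 1) * Real.exp (-(t ^ r))) - r * (t ^ (s + r - 1) * Real.exp (-(t ^ r)))) t := by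
  have h1 := Real.hasDerivAt_rpow_const (x := t) (p := s) (Or.inl ht.ne')
  have h2 := (Real.hasDerivAt_rpow_const (x := t) (p := r) (Or.inl ht.ne')).neg.exp
  convert! h1.mul h2 using 1
  have : t ^ (s + r - 1) = t ^ s * t ^ (r - 1) := by
    rw [← Real.rpow_add ht]; ring_nf
  rw [this]; simp only [Pi.neg_apply]; ring

theorem tendsto_rpow_nhdsGT_zero {s : ℝ} (hs : 0 < s) :
    Filter.Tendsto (fun t : ℝ => t ^ s) (nhdsWithin 0 (Set.Ioi 0)) (nhds 0) := by
  have := (Real.continuousAt_rpow_const 0 s (Or.inr hs.le)).tendsto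
  rw [Real.zero_rpow hs.ne'] at this
  exact this.mono_left nhdsWithin_le_nhds

theorem tendsto_exp_neg_rpow_nhdsGT_zero {r : ℝ} (hr : 0 < r) :
    Filter.Tendsto (fun t : ℝ => Real.exp (-(t ^ r))) (nhdsWithin 0 (Set.Ioi 0)) (nhds 1) := by
  have := (Real.continuous_exp.tendsto _).comp (tendsto_rpow_nhdsGT_zero hr).neg
  simpa [Function.comp_def] using this

theorem integrableOn_rpow_mul_exp_neg {s : ℝ} (hs : -1 < s) :
    IntegrableOn (fun t : ℝ => t ^ s * Real.exp (-t)) (Set.Ioi 0) := by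
  simpa using integrableOn_rpow_mul_exp_neg_rpow hs one_pos

theorem hasDerivAt_rpow_mul_exp_neg (s : ℝ) {t : ℝ} (ht : 0 < t) :
    HasDerivAt (fun t : ℝ => t ^ s * Real.exp (-t))
      (s * (t ^ (s - 1) * Real.exp (-t)) - t ^ s * Real.exp (-t)) t := by
  simpa using hasDerivAt_rpow_mul_exp_neg_rpow s 1 ht

/-- The Fourier transform of the Gamma density. -/
theorem halfFourier_rpow_mul_exp_neg {s : ℝ} (hs : 0 < s) (x : ℝ) :
    halfFourier (fun t => t ^ (s - 1) * Real.exp (-t)) x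
      = Real.Gamma s * (1 - Complex.I * x) ^ (-s : ℂ) := by
  set K := halfFourier (fun t => t ^ (s - 1) * Real.exp (-t)) with hK
  have hi1 := integrableOn_rpow_mul_exp_neg (s := s - 1) (by linarith)
  have hi2 := integrableOn_rpow_mul_exp_neg (s := s) (by linarith)
  have hne : ∀ x : ℝ, (1 - Complex.I * x : ℂ) ≠ 0 := fun x h => by
    simpa using congrArg Complex.re h
  have hslit : ∀ x : ℝ, (1 - Complex.I * x : ℂ) ∈ Complex.slitPlane := fun x => by
    left; simp
  -- Together with `hderiv` this is the differential equation (1 - ix) K' = i s K, which makes K (1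
  -- - ix)^s constant; its value at 0 is Γ(s).
  have hparts : ∀ x : ℝ, (1 - Complex.I * x) * halfFourier (fun t => t ^ s * Real.exp (-t)) x
      = s * K x := by
    intro x
    have h := halfFourier_deriv (f := fun t => t ^ s * Real.exp (-t)) (y := 0)
      (fun t ht => hasDerivAt_rpow_mul_exp_neg s ht) hi2 ((hi1.const_mul s).sub hi2) ?_ x
    · have h2 := halfFourier_add (hi1.const_mul s) (hi2.const_mul (-1)) x
      rw [halfFourier_const_mul, halfFourier_const_mul] at h2
      have h3 : (fun t : ℝ => s * (t ^ (s - 1) * Real.exp (-t)) - t ^ s * Real.exp (-t))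
          = fun t => s * (t ^ (s - 1) * Real.exp (-t)) + -1 * (t ^ s * Real.exp (-t)) := by
        ext t; ring
      rw [h3, h2] at h
      push_cast at h
      linear_combination -h
    · simpa using (tendsto_rpow_nhdsGT_zero hs).mul
        (by simpa using tendsto_exp_neg_rpow_nhdsGT_zero one_pos :
          Filter.Tendsto (fun t : ℝ => Real.exp (-t)) (nhdsWithin 0 (Set.Ioi 0)) (nhds 1))
  have hderiv : ∀ x : ℝ, HasDerivAt K
      (Complex.I * halfFourier (fun t => t ^ s * Real.exp (-t)) x) x := by
    intro x
    have := (hasDerivAt_integral_of_dominated_loc_of_deriv_le (μ := volume.restrict (Set.Ioi 0))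
      (F := fun (x : ℝ) (t : ℝ) => Complex.exp (Complex.I * x * t)
        * ((t ^ (s - 1) * Real.exp (-t) : ℝ) : ℂ))
      (F' := fun (x : ℝ) (t : ℝ) => Complex.I * (Complex.exp (Complex.I * x * t)
        * ((t ^ s * Real.exp (-t) : ℝ) : ℂ)))
      (x₀ := x) (s := Set.univ) (bound := fun t => t ^ s * Real.exp (-t)) Filter.univ_mem
      (Filter.Eventually.of_forall fun y => (integrableOn_exp_mul hi1 y).aestronglyMeasurable)
      (integrableOn_exp_mul hi1 x)
      ((integrableOn_exp_mul hi2 x).const_mul Complex.I).aestronglyMeasurable ?_ hi2 ?_).2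
    · unfold halfFourier
      rw [← integral_const_mul]
      exact this
    · refine (ae_restrict_iff' measurableSet_Ioi).2 (Filter.Eventually.of_forall fun t ht y _ => ?_)
      rw [norm_mul, norm_mul, norm_exp_I_mul_mul, Complex.norm_real, Complex.norm_I, one_mul,
        one_mul, Real.norm_of_nonneg]
      have : (0 : ℝ) < t := ht
      positivity
    · refine (ae_restrict_iff' measurableSet_Ioi).2 (Filter.Eventually.of_forall fun t ht y _ => ?_)
      have ht0 : (0 : ℝ) < t := ht
      have h1 : HasDerivAt (fun y : ℝ => Complex.I * (y : ℂ) * t) (Complex.I * t) y := by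
        simpa using ((Complex.ofRealCLM.hasDerivAt (x := y)).const_mul Complex.I).mul_const (t : ℂ)
      have h2 := h1.cexp.mul_const ((t ^ (s - 1) * Real.exp (-t) : ℝ) : ℂ)
      convert! h2 using 1
      have : t ^ s = t * t ^ (s - 1) := by
        conv_rhs => rw [← Real.rpow_one_add' ht0.le (by linarith)]
        ring_nf
      rw [this]; push_cast; ring
  have hpow : ∀ x : ℝ, HasDerivAt (fun x : ℝ => (1 - Complex.I * x : ℂ) ^ (s : ℂ))
      (-Complex.I * (s * (1 - Complex.I * x : ℂ) ^ ((s : ℂ) - 1))) x := by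
    intro x
    have h1 : HasDerivAt (fun z : ℂ => 1 - Complex.I * z) (-Complex.I) (x : ℂ) := by
      simpa using ((hasDerivAt_id (x : ℂ)).const_mul Complex.I).const_sub 1
    have := (h1.cpow_const (c := (s : ℂ)) (hslit x)).comp_ofReal
    convert! this using 1
    ring
  have hconst : ∀ x : ℝ, HasDerivAt (fun x : ℝ => K x * (1 - Complex.I * x : ℂ) ^ (s : ℂ)) 0 x := by
    intro x
    convert! (hderiv x).mul (hpow x) using 1
    rw [Complex.cpow_sub _ _ (hne x), Complex.cpow_one]
    have := hparts x
    field_simp [hne x]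
    linear_combination -Complex.I * (1 - Complex.I * x) ^ (s : ℂ) * this
  have hval : K x * (1 - Complex.I * x : ℂ) ^ (s : ℂ) = K 0 * (1 - Complex.I * (0 : ℝ) : ℂ) ^ (s : ℂ) :=
    is_const_of_deriv_eq_zero (fun y => (hconst y).differentiableAt) (fun y => (hconst y).deriv) x 0
  have hK0 : K 0 = Real.Gamma s := by
    rw [Real.Gamma_eq_integral hs, hK]
    unfold halfFourier
    rw [← integral_complex_ofReal]
    congr 1; ext t
    simp [mul_comm]
  rw [hK0] at hval
  simp only [Complex.ofReal_zero, mul_zero, sub_zero, Complex.one_cpow, mul_one] at hval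
  rw [← hval, Complex.cpow_neg, mul_assoc, mul_inv_cancel₀, mul_one]
  rw [Complex.cpow_ne_zero_iff]
  exact Or.inl (hne x)

/-! ### Tail asymptotics of the stable density. -/

theorem integrableOn_exp_neg_rpow {p : ℝ} (hp : 0 < p) :
    IntegrableOn (fun t : ℝ => Real.exp (-(t ^ p))) (Set.Ioi 0) := by
  simpa using integrableOn_rpow_mul_exp_neg_rpow (s := 0) (by norm_num) hp

theorem stableDensity_eq_re {p : ℝ} (hp : 0 < p) (x : ℝ) :
    stableDensity p x = 1 / Real.pi * (halfFourier (fun t => Real.exp (-(t ^ p))) x).re := by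
  rw [halfFourier_re (integrableOn_exp_neg_rpow hp)]
  rfl

/-- One integration by parts; the boundary term is real, so it disappears from the imaginary part.
-/
theorem mul_stableDensity {p : ℝ} (hp : 0 < p) (x : ℝ) :
    x * stableDensity p x
      = p / Real.pi * (halfFourier (fun t => t ^ (p - 1) * Real.exp (-(t ^ p))) x).im := by
  have h := halfFourier_deriv (f := fun t => Real.exp (-(t ^ p))) (y := 1)
    (f' := fun t => -p * (t ^ (p - 1) * Real.exp (-(t ^ p)))) (fun t ht => ?_)
    (integrableOn_exp_neg_rpow hp)
    ((integrableOn_rpow_mul_exp_neg_rpow (by linarith) hp).const_mul _)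
    (tendsto_exp_neg_rpow_nhdsGT_zero hp) x
  · rw [halfFourier_const_mul] at h
    have him := congrArg Complex.im h
    simp at him
    rw [stableDensity_eq_re hp]
    have : Real.pi ≠ 0 := Real.pi_ne_zero
    field_simp
    linear_combination -him
  · have := hasDerivAt_rpow_mul_exp_neg_rpow 0 p ht
    simpa using this

/-- The factor a + b supplies the cancellation at the origin, and keeping both exponentials
preserves integrability at infinity. -/
theorem abs_exp_neg_sub_exp_neg_le {a b : ℝ} (ha : 0 ≤ a) (hb : 0 ≤ b) :
    |Real.exp (-a) - Real.exp (-b)| ≤ (a + b) * (Real.exp (-a) + Real.exp (-b)) := by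
  have ea := Real.exp_pos (-a)
  have eb := Real.exp_pos (-b)
  have k1 : Real.exp (-a) = Real.exp (-b) * Real.exp (b - a) := by
    rw [← Real.exp_add]; ring_nf
  have k2 : Real.exp (-b) = Real.exp (-a) * Real.exp (a - b) := by
    rw [← Real.exp_add]; ring_nf
  have l1 := Real.add_one_le_exp (b - a)
  have l2 := Real.add_one_le_exp (a - b)
  have m1 : Real.exp (-b) * (b - a + 1) ≤ Real.exp (-a) := by rw [k1]; gcongr
  have m2 : Real.exp (-a) * (a - b + 1) ≤ Real.exp (-b) := by rw [k2]; gcongr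
  rw [abs_le]
  constructor <;> nlinarith [mul_nonneg ha ea.le, mul_nonneg ha eb.le, mul_nonneg hb ea.le,
    mul_nonneg hb eb.le]

/-- Near 0 the difference of the exponentials gains a factor of order t + t^p. For p > 1 the
function and its derivative therefore tend to 0 there and the second derivative is integrable, so
two integrations by parts leave no boundary term. At p = 1 the difference is zero. -/
theorem norm_halfFourier_remainder_le {p : ℝ} (hp1 : 1 ≤ p) :
    ∃ C : ℝ, ∀ x : ℝ, x ^ 2 * ‖halfFourier
      (fun t => t ^ (p - 1) * Real.exp (-(t ^ p)) - t ^ (p - 1) * Real.exp (-t)) x‖ ≤ C := by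
  rcases hp1.eq_or_lt with rfl | hp
  · refine ⟨0, fun x => ?_⟩
    simp [halfFourier]
  have hp0 : 0 < p := by linarith
  set G : ℝ → ℝ := fun t => t ^ (p - 1) * Real.exp (-(t ^ p)) - t ^ (p - 1) * Real.exp (-t)
    with hG
  set G₁ : ℝ → ℝ := fun t => (p - 1) * (t ^ (p - 2) * Real.exp (-(t ^ p)))
    - p * (t ^ (2 * p - 2) * Real.exp (-(t ^ p)))
    - ((p - 1) * (t ^ (p - 2) * Real.exp (-t)) - t ^ (p - 1) * Real.exp (-t)) with hG₁
  set G₂ : ℝ → ℝ := fun t =>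
    (p - 1) * ((p - 2) * (t ^ (p - 3) * Real.exp (-(t ^ p)))
        - p * (t ^ (2 * p - 3) * Real.exp (-(t ^ p))))
      - p * ((2 * p - 2) * (t ^ (2 * p - 3) * Real.exp (-(t ^ p)))
        - p * (t ^ (3 * p - 3) * Real.exp (-(t ^ p))))
      - ((p - 1) * ((p - 2) * (t ^ (p - 3) * Real.exp (-t)) - t ^ (p - 2) * Real.exp (-t))
        - ((p - 1) * (t ^ (p - 2) * Real.exp (-t)) - t ^ (p - 1) * Real.exp (-t))) with hG₂
  have dE : ∀ s t : ℝ, 0 < t → _ := fun s t ht => hasDerivAt_rpow_mul_exp_neg_rpow s p (t := t) ht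
  have dD : ∀ s t : ℝ, 0 < t → _ := fun s t ht => hasDerivAt_rpow_mul_exp_neg s (t := t) ht
  have d1 : ∀ t ∈ Set.Ioi (0 : ℝ), HasDerivAt G (G₁ t) t := by
    intro t ht
    convert! (dE (p - 1) t ht).sub (dD (p - 1) t ht) using 1
    simp only [hG₁]
    ring_nf
  have d2 : ∀ t ∈ Set.Ioi (0 : ℝ), HasDerivAt G₁ (G₂ t) t := by
    intro t ht
    convert! (((dE (p - 2) t ht).const_mul (p - 1)).sub ((dE (2 * p - 2) t ht).const_mul p)).sub
      (((dD (p - 2) t ht).const_mul (p - 1)).sub (dD (p - 1) t ht)) using 1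
    simp only [hG₂]
    ring_nf
  have iE : ∀ s : ℝ, -1 < s →
      IntegrableOn (fun t : ℝ => t ^ s * Real.exp (-(t ^ p))) (Set.Ioi 0) := fun s hs =>
    integrableOn_rpow_mul_exp_neg_rpow hs hp0
  have iD : ∀ s : ℝ, -1 < s → IntegrableOn (fun t : ℝ => t ^ s * Real.exp (-t)) (Set.Ioi 0) :=
    fun s hs => integrableOn_rpow_mul_exp_neg hs
  have i0 : IntegrableOn G (Set.Ioi 0) := (iE _ (by linarith)).sub (iD _ (by linarith))
  have i1 : IntegrableOn G₁ (Set.Ioi 0) :=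
    (((iE _ (by linarith)).const_mul _).sub ((iE _ (by linarith)).const_mul _)).sub
      (((iD _ (by linarith)).const_mul _).sub (iD _ (by linarith)))
  -- For p ≤ 2 neither term is integrable at 0 alone; the difference is dominated by powers 2p - 3
  -- and p - 2, both above -1.
  have iS : IntegrableOn (fun t : ℝ => t ^ (p - 3) * Real.exp (-(t ^ p))
      - t ^ (p - 3) * Real.exp (-t)) (Set.Ioi 0) := by
    have hb := ((iE (2 * p - 3) (by linarith)).add (iE (p - 2) (by linarith))).add
      ((iD (2 * p - 3) (by linarith)).add (iD (p - 2) (by linarith)))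
    refine Integrable.mono' hb (by fun_prop) ?_
    refine (ae_restrict_iff' measurableSet_Ioi).2 (Filter.Eventually.of_forall fun t ht => ?_)
    have ht0 : (0 : ℝ) < t := ht
    have h := abs_exp_neg_sub_exp_neg_le (Real.rpow_nonneg ht0.le p) ht0.le
    have e1 : t ^ (2 * p - 3) = t ^ (p - 3) * t ^ p := by
      rw [← Real.rpow_add ht0]; ring_nf
    have e2 : t ^ (p - 2) = t ^ (p - 3) * t := by
      rw [← Real.rpow_add_one ht0.ne']; ring_nf
    simp only [Pi.add_apply]
    rw [e1, e2, ← mul_sub, Real.norm_eq_abs, abs_mul, abs_of_pos (Real.rpow_pos_of_pos ht0 _)]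
    calc _ ≤ t ^ (p - 3) * ((t ^ p + t) * (Real.exp (-t ^ p) + Real.exp (-t))) := by gcongr
      _ = _ := by ring
  have i2 : IntegrableOn G₂ (Set.Ioi 0) := by
    have h := (((iS.const_mul ((p - 1) * (p - 2))).sub
      ((iE (2 * p - 3) (by linarith)).const_mul ((p - 1) * p + p * (2 * p - 2)))).add
      ((iE (3 * p - 3) (by linarith)).const_mul (p * p))).add
      (((iD (p - 2) (by linarith)).const_mul (2 * (p - 1))).sub (iD (p - 1) (by linarith)))
    refine h.congr (Filter.Eventually.of_forall fun t => ?_)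
    simp only [hG₂, Pi.add_apply, Pi.sub_apply]
    ring
  have tD : Filter.Tendsto (fun t : ℝ => Real.exp (-t)) (nhdsWithin 0 (Set.Ioi 0)) (nhds 1) := by
    simpa using tendsto_exp_neg_rpow_nhdsGT_zero one_pos
  have tE := tendsto_exp_neg_rpow_nhdsGT_zero hp0
  have t0 : Filter.Tendsto G (nhdsWithin 0 (Set.Ioi 0)) (nhds 0) := by
    have := ((tendsto_rpow_nhdsGT_zero (s := p - 1) (by linarith)).mul tE).sub
      ((tendsto_rpow_nhdsGT_zero (s := p - 1) (by linarith)).mul tD)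
    simpa using this
  have tS : Filter.Tendsto (fun t : ℝ => t ^ (p - 2) * Real.exp (-(t ^ p))
      - t ^ (p - 2) * Real.exp (-t)) (nhdsWithin 0 (Set.Ioi 0)) (nhds 0) := by
    have hb := ((tendsto_rpow_nhdsGT_zero (s := 2 * p - 2) (by linarith)).add
      (tendsto_rpow_nhdsGT_zero (s := p - 1) (by linarith))).mul (tE.add tD)
    rw [add_zero, zero_mul] at hb
    refine squeeze_zero_norm' ?_ hb
    filter_upwards [self_mem_nhdsWithin] with t ht
    have ht0 : (0 : ℝ) < t := ht
    have h := abs_exp_neg_sub_exp_neg_le (Real.rpow_nonneg ht0.le p) ht0.le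
    have e1 : t ^ (2 * p - 2) = t ^ (p - 2) * t ^ p := by
      rw [← Real.rpow_add ht0]; ring_nf
    have e2 : t ^ (p - 1) = t ^ (p - 2) * t := by
      rw [← Real.rpow_add_one ht0.ne']; ring_nf
    rw [e1, e2, ← mul_sub, Real.norm_eq_abs, abs_mul, abs_of_pos (Real.rpow_pos_of_pos ht0 _)]
    calc _ ≤ t ^ (p - 2) * ((t ^ p + t) * (Real.exp (-t ^ p) + Real.exp (-t))) := by gcongr
      _ = _ := by ring
  have t1 : Filter.Tendsto G₁ (nhdsWithin 0 (Set.Ioi 0)) (nhds 0) := by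
    have h := ((tS.const_mul (p - 1)).sub
      (((tendsto_rpow_nhdsGT_zero (s := 2 * p - 2) (by linarith)).mul tE).const_mul p)).add
      ((tendsto_rpow_nhdsGT_zero (s := p - 1) (by linarith)).mul tD)
    simp only [mul_zero, zero_mul, sub_zero, add_zero] at h
    refine h.congr fun t => ?_
    simp only [hG₁]
    ring
  refine ⟨∫ t in Set.Ioi (0 : ℝ), |G₂ t|, fun x => ?_⟩
  have f1 := halfFourier_deriv d1 i0 i1 t0 x
  have f2 := halfFourier_deriv d2 i1 i2 t1 x
  have : halfFourier G₂ x = (x ^ 2 : ℝ) * (- halfFourier G x) * (Complex.I * Complex.I) * (-1) := by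
    rw [f2, f1, Complex.ofReal_pow, Complex.ofReal_zero]; ring
  have hn : x ^ 2 * ‖halfFourier G x‖ = ‖halfFourier G₂ x‖ := by
    rw [this, Complex.I_mul_I]
    simp
  rw [hn]
  exact norm_halfFourier_le _ _

/-- Factor 1 - ix = x (1/x - i): positive factors leave the principal branch, so x^p cancels and the
limit is the imaginary part of (-i)^(-p). -/
theorem tendsto_rpow_mul_one_sub_I_mul_cpow_im (p : ℝ) :
    Filter.Tendsto (fun x : ℝ => x ^ p * ((1 - Complex.I * x : ℂ) ^ (-p : ℂ)).im) Filter.atTop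
      (nhds (Real.sin (p * Real.pi / 2))) := by
  have hI : (-Complex.I : ℂ) ∈ Complex.slitPlane := by
    right; simp
  have h1 : Filter.Tendsto (fun x : ℝ => ((x⁻¹ : ℝ) : ℂ) - Complex.I) Filter.atTop
      (nhds (-Complex.I)) := by
    have := ((Complex.continuous_ofReal.tendsto 0).comp tendsto_inv_atTop_zero).sub_const Complex.I
    simpa [Function.comp_def] using this
  have h2 := ((continuousAt_cpow_const (b := (-p : ℂ)) hI).tendsto.comp h1)
  have h3 := (Complex.continuous_im.tendsto _).comp h2
  have hv : ((-Complex.I) ^ (-p : ℂ)).im = Real.sin (p * Real.pi / 2) := by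
    rw [Complex.cpow_def_of_ne_zero (by simp), Complex.log_neg_I]
    have : (-(Real.pi / 2) * Complex.I : ℂ) * (-p : ℂ) = ((p * Real.pi / 2 : ℝ) : ℂ) * Complex.I := by
      push_cast; ring
    rw [this, Complex.exp_ofReal_mul_I_im]
  rw [hv] at h3
  refine h3.congr' ?_
  filter_upwards [Filter.eventually_gt_atTop 0] with x hx
  have hne : ((x⁻¹ : ℝ) : ℂ) - Complex.I ≠ 0 := fun h => by simpa using congrArg Complex.im h
  have hne' : (1 - Complex.I * x : ℂ) ≠ 0 := fun h => by simpa using congrArg Complex.re h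
  have hx' : (x : ℂ) ≠ 0 := by exact_mod_cast hx.ne'
  have e : (1 - Complex.I * x : ℂ) = (x : ℂ) * (((x⁻¹ : ℝ) : ℂ) - Complex.I) := by
    push_cast; field_simp
  have key : (1 - Complex.I * x : ℂ) ^ (-p : ℂ)
      = ((x ^ (-p) : ℝ) : ℂ) * (((x⁻¹ : ℝ) : ℂ) - Complex.I) ^ (-p : ℂ) := by
    rw [Complex.cpow_def_of_ne_zero hne', Complex.cpow_def_of_ne_zero hne, e,
      Complex.log_ofReal_mul hx hne, add_mul, Complex.exp_add, Real.rpow_def_of_pos hx]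
    push_cast
    rfl
  rw [key, Complex.im_ofReal_mul, ← mul_assoc, ← Real.rpow_add hx]
  simp

/-- The tail asymptotics of the symmetric stable density, `p < 2`. -/
theorem tendsto_rpow_mul_stableDensity {p : ℝ} (hp1 : 1 ≤ p) (hp2 : p < 2) :
    Filter.Tendsto (fun x : ℝ => x ^ (p + 1) * stableDensity p x) Filter.atTop
      (nhds (p / Real.pi * (Real.Gamma p * Real.sin (p * Real.pi / 2)))) := by
  have hp0 : 0 < p := by linarith
  obtain ⟨C, hC⟩ := norm_halfFourier_remainder_le hp1
  set R := halfFourier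
      (fun t => t ^ (p - 1) * Real.exp (-(t ^ p)) - t ^ (p - 1) * Real.exp (-t)) with hR
  have hsplit : ∀ x : ℝ, halfFourier (fun t => t ^ (p - 1) * Real.exp (-(t ^ p))) x
      = R x + Real.Gamma p * (1 - Complex.I * x : ℂ) ^ (-p : ℂ) := by
    intro x
    have i1 := integrableOn_rpow_mul_exp_neg_rpow (s := p - 1) (by linarith) hp0
    have i2 := integrableOn_rpow_mul_exp_neg (s := p - 1) (by linarith)
    have h := halfFourier_add (f := fun t => t ^ (p - 1) * Real.exp (-(t ^ p))
      - t ^ (p - 1) * Real.exp (-t)) (i1.sub i2) i2 x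
    rw [← halfFourier_rpow_mul_exp_neg hp0, hR, ← h]
    simp
  have hsmall : Filter.Tendsto (fun x : ℝ => x ^ p * (R x).im) Filter.atTop (nhds 0) := by
    have hb : Filter.Tendsto (fun x : ℝ => C * x ^ (-(2 - p))) Filter.atTop (nhds 0) := by
      simpa using (tendsto_rpow_neg_atTop (y := 2 - p) (by linarith)).const_mul C
    refine squeeze_zero_norm' ?_ hb
    filter_upwards [Filter.eventually_gt_atTop 0] with x hx
    have e : x ^ p = x ^ (-(2 - p)) * x ^ 2 := by
      rw [← Real.rpow_natCast x 2, ← Real.rpow_add hx]; congr 1; push_cast; ring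
    rw [Real.norm_eq_abs, abs_mul, abs_of_pos (Real.rpow_pos_of_pos hx p), e, mul_assoc, mul_comm C]
    refine mul_le_mul_of_nonneg_left ?_ (Real.rpow_nonneg hx.le _)
    exact (mul_le_mul_of_nonneg_left (Complex.abs_im_le_norm _) (sq_nonneg x)).trans (hC x)
  have h := (hsmall.add ((tendsto_rpow_mul_one_sub_I_mul_cpow_im p).const_mul
    (Real.Gamma p))).const_mul (p / Real.pi)
  rw [zero_add] at h
  refine h.congr' ?_
  filter_upwards [Filter.eventually_gt_atTop 0] with x hx
  rw [Real.rpow_add_one hx.ne', mul_assoc, mul_stableDensity hp0, hsplit, Complex.add_im,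
    Complex.im_ofReal_mul]
  ring

/-! ### Elementary properties and the explicit densities for p = 1 and p = 2. -/

theorem stableDensity_neg (p x : ℝ) : stableDensity p (-x) = stableDensity p x := by
  simp [stableDensity]

theorem stableDensity_abs (p x : ℝ) : stableDensity p |x| = stableDensity p x := by
  rcases abs_choice x with h | h <;> rw [h]
  exact stableDensity_neg p x

theorem continuous_stableDensity {p : ℝ} (hp : 0 < p) : Continuous (stableDensity p) := by
  refine continuous_const.mul ?_
  refine continuous_of_dominated (bound := fun t => Real.exp (-(t ^ p))) (fun x => ?_)
    (fun x => ?_) (integrableOn_exp_neg_rpow hp) ?_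
  · fun_prop
  · refine Filter.Eventually.of_forall fun t => ?_
    rw [norm_mul, Real.norm_eq_abs, Real.norm_eq_abs, Real.abs_exp]
    exact mul_le_of_le_one_left (Real.exp_pos _).le (Real.abs_cos_le_one _)
  · exact Filter.Eventually.of_forall fun t => by fun_prop

theorem abs_stableDensity_le {p : ℝ} (hp : 0 < p) (x : ℝ) :
    |stableDensity p x| ≤ 1 / Real.pi * ∫ t in Set.Ioi (0 : ℝ), Real.exp (-(t ^ p)) := by
  rw [stableDensity_eq_re hp, abs_mul, abs_of_pos (by positivity)]
  gcongr
  refine (Complex.abs_re_le_norm _).trans ((norm_halfFourier_le _ _).trans (le_of_eq ?_))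
  simp

theorem stableDensity_zero_pos {p : ℝ} (hp : 0 < p) : 0 < stableDensity p 0 := by
  unfold stableDensity
  simp only [mul_zero, Real.cos_zero, one_mul]
  refine mul_pos (by positivity) ?_
  rw [setIntegral_pos_iff_support_of_nonneg_ae
    (Filter.Eventually.of_forall fun t => (Real.exp_pos _).le) (integrableOn_exp_neg_rpow hp)]
  have : Function.support (fun t : ℝ => Real.exp (-(t ^ p))) = Set.univ := by
    ext t; simp
  rw [this, Set.univ_inter]
  simp

theorem stableDensity_one (x : ℝ) : stableDensity 1 x = 1 / Real.pi * (1 / (1 + x ^ 2)) := by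
  rw [stableDensity_eq_re one_pos]
  have h := halfFourier_rpow_mul_exp_neg one_pos x
  simp only [sub_self, Real.rpow_zero, one_mul, Real.Gamma_one, Complex.ofReal_one] at h
  simp only [Real.rpow_one]
  rw [h, Complex.cpow_neg_one, Complex.inv_re]
  simp [Complex.normSq_apply, sq]

/-- Needed separately because the asymptotic constant, which contains sin(pπ/2), vanishes at p = 2.
-/
theorem stableDensity_two (x : ℝ) :
    stableDensity 2 x = 1 / (2 * Real.sqrt Real.pi) * Real.exp (-(x ^ 2 / 4)) := by
  have h1 : 2 * (∫ t in Set.Ioi (0 : ℝ), Real.cos (t * x) * Real.exp (-(t ^ (2 : ℝ))))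
      = ∫ t : ℝ, Real.cos (t * x) * Real.exp (-(t ^ 2)) := by
    rw [← integral_comp_abs (f := fun t : ℝ => Real.cos (t * x) * Real.exp (-(t ^ (2 : ℝ))))]
    congr 1; ext t
    have : Real.cos (|t| * x) = Real.cos (t * x) := by
      rcases abs_choice t with h | h <;> rw [h]
      rw [neg_mul, Real.cos_neg]
    rw [this, Real.rpow_two, sq_abs]
  have h2 := fourierIntegral_gaussian (b := 1) (by simp) x
  have hint : Integrable fun t : ℝ =>
      Complex.exp (Complex.I * x * t) * Complex.exp (-1 * (t : ℂ) ^ 2) := by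
    refine Integrable.bdd_mul (c := 1) ?_ ?_ ?_
    · have := (integrable_exp_neg_mul_sq (b := 1) one_pos).ofReal (𝕜 := ℂ)
      refine this.congr (Filter.Eventually.of_forall fun t => ?_)
      simp
    · exact (by fun_prop : Continuous fun t : ℝ =>
        Complex.exp (Complex.I * x * t)).aestronglyMeasurable
    · exact Filter.Eventually.of_forall fun t => (norm_exp_I_mul_mul x t).le
  have h3 := integral_re (𝕜 := ℂ) hint
  simp only [RCLike.re_to_complex] at h3
  rw [h2] at h3
  have h4 : ∀ t : ℝ, (Complex.exp (Complex.I * x * t) * Complex.exp (-1 * (t : ℂ) ^ 2)).re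
      = Real.cos (t * x) * Real.exp (-(t ^ 2)) := by
    intro t
    have : Complex.exp (-1 * (t : ℂ) ^ 2) = ((Real.exp (-(t ^ 2)) : ℝ) : ℂ) := by
      push_cast; ring_nf
    rw [this, Complex.re_mul_ofReal, Complex.exp_re]
    simp [mul_comm]
  simp only [h4] at h3
  have h5 : ((Real.pi : ℂ) / 1) ^ (1 / 2 : ℂ) * Complex.exp (-(x : ℂ) ^ 2 / (4 * 1))
      = ((Real.sqrt Real.pi * Real.exp (-(x ^ 2 / 4)) : ℝ) : ℂ) := by
    rw [Real.sqrt_eq_rpow, Complex.ofReal_mul, Complex.ofReal_cpow Real.pi_pos.le]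
    push_cast
    ring_nf
  rw [h5, Complex.ofReal_re, ← h1] at h3
  unfold stableDensity
  have hs : Real.sqrt Real.pi * Real.sqrt Real.pi = Real.pi := Real.mul_self_sqrt Real.pi_pos.le
  have hs0 : Real.sqrt Real.pi ≠ 0 := by positivity
  have h6 : (∫ t in Set.Ioi (0 : ℝ), Real.cos (t * x) * Real.exp (-(t ^ (2 : ℝ))))
      = Real.sqrt Real.pi * Real.exp (-(x ^ 2 / 4)) / 2 := by linarith
  rw [h6]
  nth_rewrite 1 [← hs]
  field_simp

/-! ### Quantitative density bounds. -/

/-- Quantitative bounds for a density `h` with tails of order `x ^ (-(p + 1))`: boundedness, a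
matching lower tail when `p < 2`, a much lighter tail when `p = 2`, and non-degeneracy near `0`. -/
structure DensityBounds (p B b r x₀ : ℝ) (h : ℝ → ℝ) : Prop where
  continuous : Continuous h
  upper_pos : 0 < B
  lower_pos : 0 < b
  radius_pos : 0 < r
  radius_le : r ≤ 1
  one_le : 1 ≤ x₀
  bound : ∀ x, |h x| ≤ B
  tail : ∀ x, 1 ≤ x → |h x| ≤ B * x ^ (-(p + 1))
  tail_two : p = 2 → ∀ x, 1 ≤ x → |h x| ≤ B * x ^ (-5 : ℝ)
  core : ∀ x, 0 ≤ x → x ≤ r → b ≤ h x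
  lower_tail : p < 2 → ∀ x, x₀ ≤ x → b * x ^ (-(p + 1)) ≤ h x

theorem exists_le_stableDensity_of_le {p : ℝ} (hp : 0 < p) :
    ∃ b r : ℝ, 0 < b ∧ 0 < r ∧ r ≤ 1 ∧ ∀ x, 0 ≤ x → x ≤ r → b ≤ stableDensity p x := by
  have h0 := stableDensity_zero_pos hp
  have hc := (continuous_stableDensity hp).continuousAt (x := 0)
  have := hc.eventually (lt_mem_nhds (half_lt_self h0))
  obtain ⟨r, hr, hr'⟩ := Metric.eventually_nhds_iff.1 this
  refine ⟨stableDensity p 0 / 2, min 1 (r / 2), by linarith, by positivity, min_le_left _ _,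
    fun x hx0 hx => (hr' ?_).le⟩
  rw [Real.dist_eq, sub_zero, abs_of_nonneg hx0]
  have := hx.trans (min_le_right _ _)
  linarith

theorem exists_densityBounds_stableDensity {p : ℝ} (hp1 : 1 ≤ p) (hp2 : p ≤ 2) :
    ∃ B b r x₀ : ℝ, DensityBounds p B b r x₀ (stableDensity p) := by
  have hp0 : 0 < p := by linarith
  obtain ⟨b₁, r, hb₁, hr, hr1, hcore⟩ := exists_le_stableDensity_of_le hp0
  set M := 1 / Real.pi * ∫ t in Set.Ioi (0 : ℝ), Real.exp (-(t ^ p)) with hM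
  have hMb := abs_stableDensity_le hp0
  have hM0 : 0 < M := (abs_pos.2 (stableDensity_zero_pos hp0).ne').trans_le (hMb 0)
  rcases hp2.lt_or_eq with hp2 | rfl
  · set κ := p / Real.pi * (Real.Gamma p * Real.sin (p * Real.pi / 2)) with hκ
    have hκ0 : 0 < κ := by
      have h1 := Real.Gamma_pos_of_pos hp0
      have h2 : 0 < Real.sin (p * Real.pi / 2) := by
        apply Real.sin_pos_of_pos_of_lt_pi <;> nlinarith [Real.pi_pos]
      positivity
    have ht := tendsto_rpow_mul_stableDensity hp1 hp2
    rw [← hκ] at ht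
    obtain ⟨X, hX⟩ := Filter.eventually_atTop.1
      ((ht.eventually (lt_mem_nhds (half_lt_self hκ0))).and
        (ht.eventually (gt_mem_nhds (show κ < 2 * κ by linarith))))
    set Y := max X 1 with hY
    have hY1 : 1 ≤ Y := le_max_right _ _
    have hinv : ∀ x : ℝ, 0 < x → x ^ (p + 1) * x ^ (-(p + 1)) = 1 := fun x hx => by
      rw [← Real.rpow_add hx]; simp
    -- Beyond Y the limit κ pins x^(p+1) h(x) between κ/2 and 2κ; on [1, Y] the sup bound M is paid
    -- for by the factor Y^(p+1).
    refine ⟨M * Y ^ (p + 1) + 2 * κ, min b₁ (κ / 2), r, Y, continuous_stableDensity hp0,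
      by positivity, by positivity, hr, hr1, hY1, fun x => ?_, fun x hx => ?_,
      fun h => absurd h hp2.ne, fun x h0 h1 => (min_le_left _ _).trans (hcore x h0 h1),
      fun _ x hx => ?_⟩
    · have : 1 ≤ Y ^ (p + 1) := Real.one_le_rpow hY1 (by linarith)
      nlinarith [hMb x]
    · have hx0 : 0 < x := by linarith
      have hpos := Real.rpow_pos_of_pos hx0 (-(p + 1))
      rcases le_total Y x with h | h
      · have h2 := hX x ((le_max_left _ _).trans h)
        have hpos' := Real.rpow_pos_of_pos hx0 (p + 1)
        have e : |stableDensity p x|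
            = |x ^ (p + 1) * stableDensity p x| * x ^ (-(p + 1)) := by
          rw [abs_mul, abs_of_pos hpos', mul_right_comm, hinv x hx0, one_mul]
        rw [e, abs_of_pos (by linarith)]
        have : 0 ≤ M * Y ^ (p + 1) := by positivity
        gcongr
        linarith
      · have h1 : 1 ≤ Y ^ (p + 1) * x ^ (-(p + 1)) :=
          (hinv x hx0).symm.le.trans (by gcongr)
        calc _ ≤ M := hMb x
          _ ≤ M * (Y ^ (p + 1) * x ^ (-(p + 1))) := le_mul_of_one_le_right hM0.le h1
          _ ≤ (M * Y ^ (p + 1) + 2 * κ) * x ^ (-(p + 1)) := by nlinarith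
    · have hx0 : 0 < x := by linarith
      have h2 := (hX x ((le_max_left _ _).trans hx)).1
      have hpos := Real.rpow_pos_of_pos hx0 (-(p + 1))
      have e : stableDensity p x = x ^ (p + 1) * stableDensity p x * x ^ (-(p + 1)) := by
        rw [mul_right_comm, hinv x hx0, one_mul]
      rw [e]
      gcongr
      exact (min_le_right _ _).trans h2.le
  · have hg : ∀ x : ℝ, 1 ≤ x → |stableDensity 2 x| ≤ 192 * x ^ (-5 : ℝ) := by
      intro x hx
      have hx0 : 0 < x := by linarith
      have hs : 1 ≤ Real.sqrt Real.pi := by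
        rw [Real.one_le_sqrt]; linarith [Real.pi_gt_three]
      -- The cubic term of exp(x²/4) is x⁶/384, and the prefactor is at most 1/2, hence 192.
      have h1 := Real.pow_div_factorial_le_exp (x := x ^ 2 / 4) (by positivity) 3
      have e5 : x ^ (-5 : ℝ) = (x ^ 5)⁻¹ := by
        rw [Real.rpow_neg hx0.le]; norm_cast
      rw [stableDensity_two, abs_of_pos (by positivity), Real.exp_neg, e5]
      have h2 : x ^ 5 ≤ 384 * Real.exp (x ^ 2 / 4) := by
        have : x ^ 5 ≤ x ^ 6 := pow_le_pow_right₀ hx (by norm_num)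
        norm_num [Nat.factorial] at h1
        nlinarith
      have h3 : (Real.exp (x ^ 2 / 4))⁻¹ ≤ 384 * (x ^ 5)⁻¹ := by
        rw [← div_eq_mul_inv, inv_eq_one_div, div_le_div_iff₀ (Real.exp_pos _) (by positivity)]
        linarith
      have h4 : 1 / (2 * Real.sqrt Real.pi) ≤ 1 / 2 := by
        rw [div_le_div_iff₀ (by positivity) (by norm_num)]; linarith
      calc _ ≤ 1 / 2 * (384 * (x ^ 5)⁻¹) := by gcongr
        _ = _ := by ring
    refine ⟨M + 192, b₁, r, 1, continuous_stableDensity hp0, by positivity, hb₁, hr, hr1, le_rfl,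
      fun x => by linarith [hMb x], fun x hx => ?_, fun _ x hx => ?_, hcore,
      fun h => absurd h (lt_irrefl _)⟩
    · refine (hg x hx).trans ?_
      have : x ^ (-5 : ℝ) ≤ x ^ (-(2 + 1) : ℝ) := Real.rpow_le_rpow_of_exponent_le hx (by norm_num)
      gcongr
      linarith
    · refine (hg x hx).trans ?_
      have : 0 ≤ x := by linarith
      gcongr
      linarith

/-! ### Integrability and Fourier inversion. -/

theorem integrable_of_even {f : ℝ → ℝ} (hf : IntegrableOn f (Set.Ioi 0))
    (he : ∀ x, f (-x) = f x) : Integrable f := by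
  have h1 : IntegrableOn (fun x => f (-x)) (Set.Ici 0) := by
    simp only [he]
    rwa [integrableOn_Ici_iff_integrableOn_Ioi]
  have h2 : IntegrableOn f (Set.Iic 0) := by
    have := (Measure.measurePreserving_neg (volume : Measure ℝ)).integrableOn_comp_preimage
      (Homeomorph.neg ℝ).measurableEmbedding (f := f) (s := Set.Iic 0)
    rw [← this]
    simpa [Function.comp_def] using h1
  have := h2.union hf
  rwa [Set.Iic_union_Ioi, integrableOn_univ] at this

namespace DensityBounds

variable {p B b r x₀ : ℝ} {h : ℝ → ℝ}

theorem integrableOn_rpow_mul_Ioc (H : DensityBounds p B b r x₀ h) {s : ℝ} (hs : 0 ≤ s) (c d : ℝ) :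
    IntegrableOn (fun u : ℝ => u ^ s * h u) (Set.Ioc c d) := by
  have : Continuous fun u : ℝ => u ^ s * h u :=
    (Real.continuous_rpow_const hs).mul H.continuous
  exact this.integrableOn_Ioc

theorem integrableOn_rpow_mul_Ioi_one (H : DensityBounds p B b r x₀ h) {s : ℝ} (hs : 0 ≤ s)
    (hsp : s < p) : IntegrableOn (fun u : ℝ => u ^ s * h u) (Set.Ioi 1) := by
  have hc : Continuous fun u : ℝ => u ^ s * h u :=
    (Real.continuous_rpow_const hs).mul H.continuous
  refine Integrable.mono' ((integrableOn_Ioi_rpow_of_lt (a := s - (p + 1)) (c := 1) (by linarith)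
    one_pos).const_mul B) hc.aestronglyMeasurable ?_
  refine (ae_restrict_iff' measurableSet_Ioi).2 (Filter.Eventually.of_forall fun u hu => ?_)
  have hu1 : (1 : ℝ) < u := hu
  have hu0 : 0 < u := by linarith
  rw [norm_mul, Real.norm_of_nonneg (Real.rpow_nonneg hu0.le _), Real.norm_eq_abs,
    sub_eq_add_neg, Real.rpow_add hu0]
  calc _ ≤ u ^ s * (B * u ^ (-(p + 1))) := by gcongr; exact H.tail u hu1.le
    _ = _ := by ring

theorem integrableOn_rpow_mul (H : DensityBounds p B b r x₀ h) {s : ℝ} (hs : 0 ≤ s)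
    (hsp : s < p) {c : ℝ} (hc : 0 ≤ c) : IntegrableOn (fun u : ℝ => u ^ s * h u) (Set.Ioi c) := by
  have h1 := (H.integrableOn_rpow_mul_Ioc hs 0 1).union (H.integrableOn_rpow_mul_Ioi_one hs hsp)
  rw [Set.Ioc_union_Ioi_eq_Ioi zero_le_one] at h1
  exact h1.mono_set (Set.Ioi_subset_Ioi hc)

theorem integrableOn (H : DensityBounds p B b r x₀ h) (hp : 0 < p) {c : ℝ} (hc : 0 ≤ c) :
    IntegrableOn h (Set.Ioi c) := by
  simpa using H.integrableOn_rpow_mul le_rfl hp hc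

theorem integrable (H : DensityBounds p B b r x₀ h) (hp : 0 < p) (he : ∀ x, h (-x) = h x) :
    Integrable h :=
  integrable_of_even (H.integrableOn hp le_rfl) he

end DensityBounds

theorem integrable_stableDensity {p : ℝ} (hp1 : 1 ≤ p) (hp2 : p ≤ 2) :
    Integrable (stableDensity p) := by
  obtain ⟨B, b, r, x₀, H⟩ := exists_densityBounds_stableDensity hp1 hp2
  exact H.integrable (by linarith) (stableDensity_neg p)

/-- Fourier inversion: the characteristic function of the symmetric stable density. -/
theorem integral_cos_mul_stableDensity {p : ℝ} (hp1 : 1 ≤ p) (hp2 : p ≤ 2) (s : ℝ) :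
    ∫ x : ℝ, Real.cos (s * x) * stableDensity p x = Real.exp (-(|s| ^ p)) := by
  have hp0 : 0 < p := by linarith
  have hh := integrable_stableDensity hp1 hp2
  set f : ℝ → ℂ := fun t => ((Real.exp (-(|t| ^ p)) : ℝ) : ℂ) with hf
  have hfc : Continuous f := by
    have : Continuous fun t : ℝ => |t| ^ p := (Real.continuous_rpow_const hp0.le).comp continuous_abs
    fun_prop
  have hfr : Integrable fun t : ℝ => Real.exp (-(|t| ^ p)) := by
    have h1 := integrableOn_exp_neg_rpow hp0
    have h2 : IntegrableOn (fun t : ℝ => Real.exp (-(|t| ^ p))) (Set.Ioi 0) := by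
      refine h1.congr_fun (fun t ht => ?_) measurableSet_Ioi
      simp only [abs_of_pos (Set.mem_Ioi.1 ht)]
    exact integrable_of_even h2 fun t => by rw [abs_neg]
  have hfi : Integrable f := hfr.ofReal
  have hF : FourierTransform.fourier f
      = fun w : ℝ => ((2 * Real.pi * stableDensity p (2 * Real.pi * w) : ℝ) : ℂ) := by
    ext w
    rw [Real.fourier_eq']
    set g : ℝ → ℂ := fun v => Complex.exp (((-2 * Real.pi * inner ℝ v w : ℝ) : ℂ) * Complex.I) • f v
      with hg
    have hgi : Integrable g := by
      refine Integrable.bdd_mul (c := 1) hfi ?_ ?_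
      · exact (by fun_prop : Continuous fun v : ℝ =>
          Complex.exp (((-2 * Real.pi * inner ℝ v w : ℝ) : ℂ) * Complex.I)).aestronglyMeasurable
      · exact Filter.Eventually.of_forall fun v => (Complex.norm_exp_ofReal_mul_I _).le
    have h1 : ∫ v, g v = ∫ v, g (-v) := (integral_neg_eq_self g volume).symm
    -- Averaging over v and -v turns the exponential into a cosine, so the transform is
    -- `stableDensity` up to the 2π normalization.
    have h2 : (2 : ℂ) * ∫ v, g v
        = ∫ v : ℝ, ((2 * (Real.cos (|v| * (2 * Real.pi * w)) * Real.exp (-(|v| ^ p))) : ℝ) : ℂ) := by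
      rw [two_mul]
      nth_rewrite 2 [h1]
      rw [← integral_add hgi hgi.comp_neg]
      congr 1; ext v
      have hc : Real.cos (|v| * (2 * Real.pi * w)) = Real.cos (2 * Real.pi * v * w) := by
        rcases abs_choice v with h | h <;> rw [h]
        · ring_nf
        · rw [← Real.cos_neg]; ring_nf
      rw [hc]
      simp only [hg, hf, smul_eq_mul, abs_neg]
      rw [← add_mul]
      have e : Complex.exp (((-2 * Real.pi * inner ℝ v w : ℝ) : ℂ) * Complex.I)
          + Complex.exp (((-2 * Real.pi * inner ℝ (-v) w : ℝ) : ℂ) * Complex.I)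
          = 2 * ((Real.cos (2 * Real.pi * v * w) : ℝ) : ℂ) := by
        rw [Complex.ofReal_cos, Complex.two_cos, add_comm]
        simp only [RCLike.inner_apply, conj_trivial]
        push_cast
        ring_nf
      rw [e]; push_cast; ring
    rw [integral_complex_ofReal, integral_const_mul, integral_comp_abs
      (f := fun v : ℝ => Real.cos (v * (2 * Real.pi * w)) * Real.exp (-(v ^ p)))] at h2
    have h3 : (∫ v in Set.Ioi (0 : ℝ), Real.cos (v * (2 * Real.pi * w)) * Real.exp (-(v ^ p)))
        = Real.pi * stableDensity p (2 * Real.pi * w) := by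
      unfold stableDensity
      rw [← mul_assoc, mul_one_div_cancel Real.pi_ne_zero, one_mul]
    rw [h3] at h2
    have : (2 : ℂ) ≠ 0 := two_ne_zero
    apply mul_left_cancel₀ this
    rw [h2]; push_cast; ring
  -- Inversion needs an integrable transform, which the tail bounds on `h` provide.
  have hFi : Integrable (FourierTransform.fourier f) := by
    rw [hF]
    exact ((hh.comp_mul_left' (by positivity : 2 * Real.pi ≠ 0)).const_mul _).ofReal
  have hinv := congrFun (hfc.fourierInv_fourier_eq hfi hFi) s
  rw [Real.fourierInv_eq', hF] at hinv
  set g : ℝ → ℂ := fun v => Complex.exp (((2 * Real.pi * inner ℝ v s : ℝ) : ℂ) * Complex.I) •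
    ((2 * Real.pi * stableDensity p (2 * Real.pi * v) : ℝ) : ℂ) with hg
  have hgi : Integrable g := by
    rw [hF] at hFi
    refine Integrable.bdd_mul (c := 1) hFi ?_ ?_
    · exact (by fun_prop : Continuous fun v : ℝ =>
        Complex.exp (((2 * Real.pi * inner ℝ v s : ℝ) : ℂ) * Complex.I)).aestronglyMeasurable
    · exact Filter.Eventually.of_forall fun v => (Complex.norm_exp_ofReal_mul_I _).le
  have hre := integral_re (𝕜 := ℂ) hgi
  simp only [RCLike.re_to_complex] at hre
  rw [hinv] at hre
  simp only [hf, Complex.ofReal_re] at hre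
  rw [← hre]
  have hgr : ∀ v : ℝ, (g v).re = 2 * Real.pi *
      (Real.cos (s * (2 * Real.pi * v)) * stableDensity p (2 * Real.pi * v)) := by
    intro v
    simp only [hg, smul_eq_mul]
    rw [Complex.re_mul_ofReal, Complex.exp_ofReal_mul_I_re]
    simp only [RCLike.inner_apply, conj_trivial]
    ring_nf
  simp only [hgr]
  rw [integral_const_mul, Measure.integral_comp_mul_left
    (fun y : ℝ => Real.cos (s * y) * stableDensity p y), smul_eq_mul, ← mul_assoc,
    abs_of_pos (by positivity), mul_inv_cancel₀ (by positivity), one_mul]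

/-! ### Truncated moments and half-line sine moments. -/

/-- The truncated moment `∫₀^T u^q h(u) du`. -/
noncomputable def truncMoment (h : ℝ → ℝ) (q T : ℝ) : ℝ :=
  ∫ u in Set.Ioc (0 : ℝ) T, u ^ q * h u

/-- The half-line sine moment `∫₀^∞ |sin(au)|^q h(u) du`. -/
noncomputable def sinIntegral (h : ℝ → ℝ) (q a : ℝ) : ℝ :=
  ∫ u in Set.Ioi (0 : ℝ), |Real.sin (a * u)| ^ q * h u

/-- The model growth `∫₁^R u^(q-p-1) du` of the truncated `q`-th moment. -/
noncomputable def modelMoment (p q R : ℝ) : ℝ :=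
  ∫ u in Set.Ioc (1 : ℝ) R, u ^ (q - (p + 1))

theorem modelMoment_of_lt {p q R : ℝ} (hqp : q < p) (hR : 1 ≤ R) :
    modelMoment p q R = (1 - R ^ (-(p - q))) / (p - q) := by
  unfold modelMoment
  rw [← intervalIntegral.integral_of_le hR, integral_rpow]
  · have : q - (p + 1) + 1 = -(p - q) := by ring
    rw [this, Real.one_rpow, div_neg, ← neg_div, neg_sub]
  · right
    refine ⟨by linarith, ?_⟩
    rw [Set.uIcc_of_le hR]
    exact fun h => by linarith [h.1]

theorem modelMoment_self (p : ℝ) {R : ℝ} (hR : 1 ≤ R) : modelMoment p p R = Real.log R := by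
  unfold modelMoment
  rw [← intervalIntegral.integral_of_le hR]
  have : p - (p + 1) = -1 := by ring
  simp only [this, Real.rpow_neg_one]
  rw [integral_inv_of_pos one_pos (by linarith), div_one]

theorem continuous_abs_sin_rpow {q : ℝ} (hq : 0 ≤ q) (a : ℝ) :
    Continuous fun u : ℝ => |Real.sin (a * u)| ^ q :=
  (Real.continuous_rpow_const hq).comp (by fun_prop : Continuous fun u : ℝ => |Real.sin (a * u)|)

theorem abs_sin_rpow_le_one {q : ℝ} (hq : 0 ≤ q) (y : ℝ) : |Real.sin y| ^ q ≤ 1 :=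
  Real.rpow_le_one (abs_nonneg _) (Real.abs_sin_le_one _) hq

theorem integrableOn_abs_sin_rpow_mul {h : ℝ → ℝ} {s : Set ℝ} (hh : IntegrableOn h s)
    {q : ℝ} (hq : 0 ≤ q) (a : ℝ) : IntegrableOn (fun u => |Real.sin (a * u)| ^ q * h u) s := by
  refine Integrable.bdd_mul (c := 1) hh (continuous_abs_sin_rpow hq a).aestronglyMeasurable ?_
  refine Filter.Eventually.of_forall fun u => ?_
  rw [Real.norm_of_nonneg (Real.rpow_nonneg (abs_nonneg _) _)]
  exact abs_sin_rpow_le_one hq _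

/-- Integrals of power tails. -/
theorem setIntegral_Ioi_rpow_mul_le {h : ℝ → ℝ} {B m s R : ℝ} (hms : s < m - 1) (hR : 1 ≤ R)
    (hint : IntegrableOn (fun u : ℝ => u ^ s * h u) (Set.Ioi R))
    (hb : ∀ u, 1 ≤ u → |h u| ≤ B * u ^ (-m)) :
    ∫ u in Set.Ioi R, u ^ s * h u ≤ B * R ^ (s - m + 1) / (m - 1 - s) := by
  have hR0 : 0 < R := by linarith
  have h1 : ∫ u in Set.Ioi R, B * u ^ (s - m) = B * R ^ (s - m + 1) / (m - 1 - s) := by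
    rw [integral_const_mul, integral_Ioi_rpow_of_lt (by linarith) hR0]
    have h1 : s - m + 1 ≠ 0 := by linarith
    have h2 : m - 1 - s ≠ 0 := by linarith
    have h3 : s - m + 1 = -(m - 1 - s) := by ring
    rw [neg_div, ← div_neg, h3, neg_neg, mul_div_assoc]
  rw [← h1]
  refine setIntegral_mono_on hint
    ((integrableOn_Ioi_rpow_of_lt (by linarith) hR0).const_mul B) measurableSet_Ioi fun u hu => ?_
  have hu1 : R < u := hu
  have hu0 : 0 < u := by linarith
  rw [sub_eq_add_neg, Real.rpow_add hu0]
  calc _ ≤ u ^ s * (B * u ^ (-m)) := by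
        gcongr; exact (le_abs_self _).trans (hb u (by linarith))
    _ = _ := by ring

/-! ### Moment and tail estimates; cutting the sine integral. -/

namespace DensityBounds

variable {p B b r x₀ : ℝ} {h : ℝ → ℝ}

theorem truncMoment_mono (H : DensityBounds p B b r x₀ h) (hn : ∀ x, 0 ≤ h x) {q : ℝ} (hq : 0 ≤ q)
    {S T : ℝ} (hST : S ≤ T) : truncMoment h q S ≤ truncMoment h q T :=
  setIntegral_mono_set (H.integrableOn_rpow_mul_Ioc hq 0 T)
    ((ae_restrict_iff' measurableSet_Ioc).2 (Filter.Eventually.of_forall fun u hu =>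
      mul_nonneg (Real.rpow_nonneg hu.1.le _) (hn u)))
    (Set.Ioc_subset_Ioc_right hST).eventuallyLE

theorem truncMoment_add (H : DensityBounds p B b r x₀ h) {q : ℝ} (hq : 0 ≤ q)
    {S T : ℝ} (hS : 0 ≤ S) (hST : S ≤ T) :
    truncMoment h q T = truncMoment h q S + ∫ u in Set.Ioc S T, u ^ q * h u := by
  unfold truncMoment
  rw [← setIntegral_union (Set.Ioc_disjoint_Ioc_of_le le_rfl) measurableSet_Ioc
    (H.integrableOn_rpow_mul_Ioc hq 0 S) (H.integrableOn_rpow_mul_Ioc hq S T),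
    Set.Ioc_union_Ioc_eq_Ioc hS hST]

theorem moment_eq_add (H : DensityBounds p B b r x₀ h) {q : ℝ} (hq : 0 ≤ q) (hqp : q < p)
    {T : ℝ} (hT : 0 ≤ T) : ∫ u in Set.Ioi (0 : ℝ), u ^ q * h u
      = truncMoment h q T + ∫ u in Set.Ioi T, u ^ q * h u := by
  unfold truncMoment
  rw [← setIntegral_union (Set.Ioc_disjoint_Ioi le_rfl) measurableSet_Ioi
    (H.integrableOn_rpow_mul_Ioc hq 0 T) (H.integrableOn_rpow_mul hq hqp hT),
    Set.Ioc_union_Ioi_eq_Ioi hT]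

theorem sinIntegral_eq_add (H : DensityBounds p B b r x₀ h) (hp : 0 < p) {q : ℝ} (hq : 0 ≤ q)
    (a : ℝ) {T : ℝ} (hT : 0 ≤ T) : sinIntegral h q a
      = (∫ u in Set.Ioc 0 T, |Real.sin (a * u)| ^ q * h u)
        + ∫ u in Set.Ioi T, |Real.sin (a * u)| ^ q * h u := by
  unfold sinIntegral
  rw [← setIntegral_union (Set.Ioc_disjoint_Ioi le_rfl) measurableSet_Ioi
    (integrableOn_abs_sin_rpow_mul ((H.integrableOn hp le_rfl).mono_set
      Set.Ioc_subset_Ioi_self) hq a)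
    (integrableOn_abs_sin_rpow_mul (H.integrableOn hp hT) hq a),
    Set.Ioc_union_Ioi_eq_Ioi hT]

/-- Uses |sin y| ≤ |y| up to the cutoff and |sin y| ≤ 1 beyond it. -/
theorem sinIntegral_le (H : DensityBounds p B b r x₀ h) (hn : ∀ x, 0 ≤ h x) (hp : 0 < p) {q : ℝ}
    (hq : 0 ≤ q) {a : ℝ} (ha : 0 < a) {T : ℝ} (hT : 0 ≤ T) :
    sinIntegral h q a ≤ a ^ q * truncMoment h q T + ∫ u in Set.Ioi T, h u := by
  rw [H.sinIntegral_eq_add hp hq a hT]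
  unfold truncMoment
  rw [← integral_const_mul]
  refine add_le_add ?_ ?_
  · refine setIntegral_mono_on (integrableOn_abs_sin_rpow_mul ((H.integrableOn hp le_rfl).mono_set
      Set.Ioc_subset_Ioi_self) hq a) ((H.integrableOn_rpow_mul_Ioc hq 0 T).const_mul _)
      measurableSet_Ioc fun u hu => ?_
    rw [← mul_assoc, ← Real.mul_rpow ha.le hu.1.le]
    refine mul_le_mul_of_nonneg_right (Real.rpow_le_rpow (abs_nonneg _) ?_ hq) (hn u)
    have := Real.abs_sin_le_abs (x := a * u)
    rwa [abs_of_pos (mul_pos ha hu.1)] at this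
  · refine setIntegral_mono_on (integrableOn_abs_sin_rpow_mul (H.integrableOn hp hT) hq a)
      (H.integrableOn hp hT) measurableSet_Ioi fun u _ => ?_
    exact mul_le_of_le_one_left (hn u) (abs_sin_rpow_le_one hq _)

theorem sinIntegral_nonneg (hn : ∀ x, 0 ≤ h x) (q a : ℝ) : 0 ≤ sinIntegral h q a :=
  integral_nonneg fun u => mul_nonneg (Real.rpow_nonneg (abs_nonneg _) _) (hn u)

/-- The part beyond T is dropped. Leaving k free serves both the crude bound at T = 1/a and the
sharp one at T = √ε/a. -/
theorem mul_truncMoment_le_sinIntegral (H : DensityBounds p B b r x₀ h) (hn : ∀ x, 0 ≤ h x)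
    (hp : 0 < p) {q : ℝ} (hq : 0 ≤ q) {a k T : ℝ} (hT : 0 ≤ T)
    (hk : ∀ u, 0 < u → u ≤ T → k * u ^ q ≤ |Real.sin (a * u)| ^ q) :
    k * truncMoment h q T ≤ sinIntegral h q a := by
  rw [H.sinIntegral_eq_add hp hq a hT]
  have h2 : 0 ≤ ∫ u in Set.Ioi T, |Real.sin (a * u)| ^ q * h u :=
    integral_nonneg fun u => mul_nonneg (Real.rpow_nonneg (abs_nonneg _) _) (hn u)
  refine le_add_of_le_of_nonneg ?_ h2
  unfold truncMoment
  rw [← integral_const_mul]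
  refine setIntegral_mono_on ((H.integrableOn_rpow_mul_Ioc hq 0 T).const_mul _)
    (integrableOn_abs_sin_rpow_mul ((H.integrableOn hp le_rfl).mono_set
      Set.Ioc_subset_Ioi_self) hq a) measurableSet_Ioc fun u hu => ?_
  rw [← mul_assoc]
  exact mul_le_mul_of_nonneg_right (hk u hu.1 hu.2) (hn u)

theorem tail_moment_le (H : DensityBounds p B b r x₀ h) {q R : ℝ} (hq : 0 ≤ q) (hqp : q < p)
    (hR : 1 ≤ R) : ∫ u in Set.Ioi R, u ^ q * h u ≤ B * R ^ (-(p - q)) / (p - q) := by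
  have := setIntegral_Ioi_rpow_mul_le (m := p + 1) (by linarith) hR
    (H.integrableOn_rpow_mul hq hqp (by linarith)) H.tail
  convert this using 3 <;> ring_nf

theorem tail_moment_two_le (H : DensityBounds p B b r x₀ h) (hp : p = 2) {q R : ℝ} (hq : 0 ≤ q)
    (hqp : q < p) (hR : 1 ≤ R) : ∫ u in Set.Ioi R, u ^ q * h u ≤ B * R ^ (q - 4) := by
  have := setIntegral_Ioi_rpow_mul_le (m := 5) (by linarith) hR
    (H.integrableOn_rpow_mul hq hqp (by linarith)) (H.tail_two hp)
  refine this.trans ?_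
  have hB := H.upper_pos
  have e : q - 5 + 1 = q - 4 := by ring
  rw [e]
  refine div_le_self (mul_nonneg hB.le (Real.rpow_nonneg (by linarith) _)) (by linarith)

theorem tail_le (H : DensityBounds p B b r x₀ h) (hp1 : 1 ≤ p) {R : ℝ} (hR : 1 ≤ R) :
    ∫ u in Set.Ioi R, h u ≤ B * R ^ (-p) := by
  have := H.tail_moment_le (q := 0) le_rfl (by linarith) hR
  simp only [Real.rpow_zero, one_mul, sub_zero] at this
  refine this.trans (div_le_self (mul_nonneg H.upper_pos.le (Real.rpow_nonneg (by linarith) _)) hp1)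

theorem tail_two_le (H : DensityBounds p B b r x₀ h) (hp : p = 2) {R : ℝ} (hR : 1 ≤ R) :
    ∫ u in Set.Ioi R, h u ≤ B * R ^ (-4 : ℝ) := by
  simpa using H.tail_moment_two_le hp (q := 0) le_rfl (by linarith) hR

theorem truncMoment_one_le (H : DensityBounds p B b r x₀ h) {q : ℝ} (hq : 0 ≤ q) :
    truncMoment h q 1 ≤ B := by
  have h1 : ∫ u in Set.Ioc (0 : ℝ) 1, B = B := by simp
  rw [← h1]
  refine setIntegral_mono_on (H.integrableOn_rpow_mul_Ioc hq 0 1) (by simp) measurableSet_Ioc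
    fun u hu => ?_
  have h2 : u ^ q ≤ 1 := Real.rpow_le_one hu.1.le hu.2 hq
  have h3 := H.bound u
  have h4 := Real.rpow_nonneg hu.1.le q
  calc u ^ q * h u ≤ u ^ q * |h u| := by gcongr; exact le_abs_self _
    _ ≤ 1 * B := by gcongr
    _ = B := one_mul B

theorem integrableOn_rpow_Ioc {s c d : ℝ} (hc : 0 < c) :
    IntegrableOn (fun u : ℝ => u ^ s) (Set.Ioc c d) := by
  refine (ContinuousOn.integrableOn_Icc ?_).mono_set Set.Ioc_subset_Icc_self
  exact fun u hu => (Real.continuousAt_rpow_const u s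
    (Or.inl (by linarith [hu.1] : u ≠ 0))).continuousWithinAt

theorem truncMoment_le (H : DensityBounds p B b r x₀ h) {q R : ℝ} (hq : 0 ≤ q) (hR : 1 ≤ R) :
    truncMoment h q R ≤ B * (1 + modelMoment p q R) := by
  rw [H.truncMoment_add hq zero_le_one hR, mul_add, mul_one]
  refine add_le_add (H.truncMoment_one_le hq) ?_
  unfold modelMoment
  rw [← integral_const_mul]
  refine setIntegral_mono_on (H.integrableOn_rpow_mul_Ioc hq 1 R)
    ((integrableOn_rpow_Ioc one_pos).const_mul B) measurableSet_Ioc fun u hu => ?_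
  have hu0 : 0 < u := by linarith [hu.1]
  rw [sub_eq_add_neg, Real.rpow_add hu0]
  calc _ ≤ u ^ q * (B * u ^ (-(p + 1))) := by
        gcongr; exact (le_abs_self _).trans (H.tail u hu.1.le)
    _ = _ := by ring

/-- Since q ≤ 2, the integrand beyond 1 is at most a multiple of u^(-3): no logarithm appears, even
at q = p = 2. -/
theorem truncMoment_two_le (H : DensityBounds p B b r x₀ h) (hp : p = 2) {q R : ℝ} (hq : 0 ≤ q)
    (hqp : q ≤ p) (hR : 1 ≤ R) : truncMoment h q R ≤ 2 * B := by
  have hB := H.upper_pos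
  rw [H.truncMoment_add hq zero_le_one hR, two_mul]
  refine add_le_add (H.truncMoment_one_le hq) ?_
  have h1 : ∫ u in Set.Ioi (1 : ℝ), B * u ^ (-3 : ℝ) = B * (1 / 2) := by
    rw [integral_const_mul, integral_Ioi_rpow_of_lt (by norm_num) one_pos]
    norm_num
  have hi : IntegrableOn (fun u : ℝ => B * u ^ (-3 : ℝ)) (Set.Ioi 1) :=
    (integrableOn_Ioi_rpow_of_lt (by norm_num) one_pos).const_mul B
  calc _ ≤ ∫ u in Set.Ioc (1 : ℝ) R, B * u ^ (-3 : ℝ) := by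
        refine setIntegral_mono_on (H.integrableOn_rpow_mul_Ioc hq 1 R)
          (hi.mono_set Set.Ioc_subset_Ioi_self) measurableSet_Ioc fun u hu => ?_
        have hu0 : 0 < u := by linarith [hu.1]
        have h2 : h u ≤ B * u ^ (-5 : ℝ) := (le_abs_self _).trans (H.tail_two hp u hu.1.le)
        have h3 : u ^ q ≤ u ^ (2 : ℝ) := Real.rpow_le_rpow_of_exponent_le hu.1.le (by linarith)
        calc u ^ q * h u ≤ u ^ q * (B * u ^ (-5 : ℝ)) := by gcongr
          _ ≤ u ^ (2 : ℝ) * (B * u ^ (-5 : ℝ)) := by gcongr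
          _ = B * (u ^ (2 : ℝ) * u ^ (-5 : ℝ)) := by ring
          _ = _ := by rw [← Real.rpow_add hu0]; norm_num
    _ ≤ ∫ u in Set.Ioi (1 : ℝ), B * u ^ (-3 : ℝ) := by
        refine setIntegral_mono_set hi ?_ Set.Ioc_subset_Ioi_self.eventuallyLE
        refine (ae_restrict_iff' measurableSet_Ioi).2 (Filter.Eventually.of_forall fun u hu => ?_)
        have : (1 : ℝ) < u := hu
        have : 0 ≤ u ^ (-3 : ℝ) := Real.rpow_nonneg (by linarith) _
        simp only [Pi.zero_apply]
        positivity
    _ ≤ B := by rw [h1]; linarith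

/-- On [0, r] the density is at least b and u^q ≥ u², which makes the bound independent of q and R.
-/
theorem le_truncMoment (H : DensityBounds p B b r x₀ h) (hn : ∀ x, 0 ≤ h x) {q R : ℝ} (hq : 0 ≤ q)
    (hq2 : q ≤ 2) (hR : 1 ≤ R) : b * r ^ 3 / 3 ≤ truncMoment h q R := by
  have hr0 := H.radius_pos
  have hb := H.lower_pos
  refine le_trans ?_ (H.truncMoment_mono hn hq (H.radius_le.trans hR))
  have h1 : ∫ u in Set.Ioc (0 : ℝ) r, b * u ^ 2 = b * r ^ 3 / 3 := by
    rw [integral_const_mul, ← intervalIntegral.integral_of_le hr0.le, integral_pow]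
    norm_num; ring
  rw [← h1]
  refine setIntegral_mono_on ((by fun_prop : Continuous fun u : ℝ => b * u ^ 2).integrableOn_Ioc)
    (H.integrableOn_rpow_mul_Ioc hq 0 r) measurableSet_Ioc fun u hu => ?_
  have h2 : u ^ 2 ≤ u ^ q := by
    rw [← Real.rpow_two]
    exact Real.rpow_le_rpow_of_exponent_ge hu.1 (hu.2.trans H.radius_le) hq2
  have h3 := H.core u hu.1.le hu.2
  have h4 := Real.rpow_nonneg hu.1.le q
  rw [mul_comm]
  gcongr

/-- The converse of `truncMoment_le`. Beyond x₀ the lower tail compares the integrands at cost 1/b;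
up to x₀ the model moment is at most x₀ - 1, and constants are absorbed by `le_truncMoment`. -/
theorem exists_one_add_modelMoment_le (H : DensityBounds p B b r x₀ h) (hp2 : p < 2) :
    ∃ A : ℝ, 0 < A ∧ ((∀ x, 0 ≤ h x) → ∀ q R : ℝ, 0 ≤ q → q ≤ p → 1 ≤ R →
      1 + modelMoment p q R ≤ A * truncMoment h q R) := by
  have hr0 := H.radius_pos
  have hb := H.lower_pos
  have hx0 := H.one_le
  refine ⟨1 / b + (x₀ + 1) * (3 / (b * r ^ 3)), by positivity, fun hn q R hq hqp hR => ?_⟩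
  have hle : ∀ u : ℝ, 1 ≤ u → u ^ (q - (p + 1)) ≤ 1 := fun u hu =>
    Real.rpow_le_one_of_one_le_of_nonpos hu (by linarith)
  have hsmall : ∀ S : ℝ, 1 ≤ S → modelMoment p q S ≤ S - 1 := by
    intro S hS
    have h1 : ∫ u in Set.Ioc (1 : ℝ) S, (1 : ℝ) = S - 1 := by simp [hS]
    rw [← h1]
    exact setIntegral_mono_on (integrableOn_rpow_Ioc one_pos) (by simp) measurableSet_Ioc
      fun u hu => hle u hu.1.le
  have h0 := H.le_truncMoment hn hq (by linarith) hR
  have hpos : 0 ≤ truncMoment h q R := le_trans (by positivity) h0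
  have key : modelMoment p q R ≤ 1 / b * truncMoment h q R + x₀ := by
    rcases le_total R x₀ with hRx | hRx
    · have := hsmall R hR
      have : 0 ≤ 1 / b * truncMoment h q R := by positivity
      linarith
    · have hsplit : modelMoment p q R
          = modelMoment p q x₀ + ∫ u in Set.Ioc x₀ R, u ^ (q - (p + 1)) := by
        unfold modelMoment
        rw [← setIntegral_union (Set.Ioc_disjoint_Ioc_of_le le_rfl) measurableSet_Ioc
          (integrableOn_rpow_Ioc one_pos) (integrableOn_rpow_Ioc (by linarith)),
          Set.Ioc_union_Ioc_eq_Ioc hx0 hRx]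
      have h1 : ∫ u in Set.Ioc x₀ R, u ^ (q - (p + 1)) ≤ 1 / b * truncMoment h q R := by
        rw [H.truncMoment_add hq (by linarith : 0 ≤ x₀) hRx]
        have h2 : 0 ≤ truncMoment h q x₀ := setIntegral_nonneg measurableSet_Ioc fun u hu =>
          mul_nonneg (Real.rpow_nonneg hu.1.le _) (hn u)
        have h3 : ∫ u in Set.Ioc x₀ R, u ^ (q - (p + 1))
            ≤ 1 / b * ∫ u in Set.Ioc x₀ R, u ^ q * h u := by
          rw [← integral_const_mul]
          refine setIntegral_mono_on (integrableOn_rpow_Ioc (by linarith))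
            ((H.integrableOn_rpow_mul_Ioc hq x₀ R).const_mul _) measurableSet_Ioc fun u hu => ?_
          have hu0 : 0 < u := by linarith [hu.1]
          have h4 := H.lower_tail hp2 u hu.1.le
          rw [sub_eq_add_neg, Real.rpow_add hu0]
          calc u ^ q * u ^ (-(p + 1)) = 1 / b * (u ^ q * (b * u ^ (-(p + 1)))) := by field_simp
            _ ≤ _ := by gcongr
        have h5 : 0 ≤ 1 / b * truncMoment h q x₀ := by positivity
        linarith
      have := hsmall x₀ hx0
      linarith
  have h6 : x₀ + 1 ≤ (x₀ + 1) * (3 / (b * r ^ 3)) * truncMoment h q R := by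
    rw [mul_assoc]
    refine le_mul_of_one_le_right (by linarith) ?_
    calc (1 : ℝ) = 3 / (b * r ^ 3) * (b * r ^ 3 / 3) := by field_simp
      _ ≤ _ := by gcongr
  linarith

/-- Lower bound for the full moment when `p < 2`. -/
theorem le_mul_moment (H : DensityBounds p B b r x₀ h) (hn : ∀ x, 0 ≤ h x) (hp2 : p < 2)
    {q : ℝ} (hq : 1 ≤ q) (hqp : q < p) :
    1 / (p - q) ≤ x₀ / b * ∫ u in Set.Ioi (0 : ℝ), u ^ q * h u := by
  have hb := H.lower_pos
  have hx0 := H.one_le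
  have hx0' : 0 < x₀ := by linarith
  have hpq : 0 < p - q := by linarith
  rw [H.moment_eq_add (by linarith) hqp hx0'.le]
  have h2 : 0 ≤ truncMoment h q x₀ := setIntegral_nonneg measurableSet_Ioc fun u hu =>
    mul_nonneg (Real.rpow_nonneg hu.1.le _) (hn u)
  have h1 : ∫ u in Set.Ioi x₀, b * u ^ (q - (p + 1)) = b * (x₀ ^ (-(p - q)) / (p - q)) := by
    rw [integral_const_mul, integral_Ioi_rpow_of_lt (by linarith) hx0']
    have : q - (p + 1) + 1 = -(p - q) := by ring
    rw [this, neg_div_neg_eq]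
  have h3 : b * (x₀ ^ (-(p - q)) / (p - q)) ≤ ∫ u in Set.Ioi x₀, u ^ q * h u := by
    rw [← h1]
    refine setIntegral_mono_on ((integrableOn_Ioi_rpow_of_lt (by linarith) hx0').const_mul b)
      (H.integrableOn_rpow_mul (by linarith) hqp hx0'.le) measurableSet_Ioi fun u hu => ?_
    have hu1 : x₀ < u := hu
    have hu0 : 0 < u := by linarith
    have h4 := H.lower_tail hp2 u hu1.le
    rw [sub_eq_add_neg, Real.rpow_add hu0]
    calc b * (u ^ q * u ^ (-(p + 1))) = u ^ q * (b * u ^ (-(p + 1))) := by ring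
      _ ≤ _ := by gcongr
  -- As p - q ≤ 1, the constant does not depend on q.
  have h5 : x₀⁻¹ ≤ x₀ ^ (-(p - q)) := by
    rw [← Real.rpow_neg_one]
    exact Real.rpow_le_rpow_of_exponent_le hx0 (by linarith)
  calc 1 / (p - q) = x₀ / b * (b * (x₀⁻¹ / (p - q))) := by field_simp
    _ ≤ x₀ / b * (b * (x₀ ^ (-(p - q)) / (p - q))) := by gcongr
    _ ≤ _ := by gcongr; linarith

theorem le_moment (H : DensityBounds p B b r x₀ h) (hn : ∀ x, 0 ≤ h x) (hp2 : p ≤ 2)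
    {q : ℝ} (hq : 0 ≤ q) (hqp : q < p) :
    b * r ^ 3 / 3 ≤ ∫ u in Set.Ioi (0 : ℝ), u ^ q * h u := by
  rw [H.moment_eq_add hq hqp zero_le_one]
  have h1 := H.le_truncMoment hn hq (by linarith) le_rfl
  have h2 : 0 ≤ ∫ u in Set.Ioi (1 : ℝ), u ^ q * h u :=
    setIntegral_nonneg measurableSet_Ioi fun u hu =>
      mul_nonneg (Real.rpow_nonneg (by linarith [Set.mem_Ioi.1 hu]) _) (hn u)
  linarith

theorem moment_le (H : DensityBounds p B b r x₀ h) {q : ℝ} (hq : 0 ≤ q) (hqp : q < p) :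
    ∫ u in Set.Ioi (0 : ℝ), u ^ q * h u ≤ B * (1 + 1 / (p - q)) := by
  rw [H.moment_eq_add hq hqp zero_le_one]
  have h1 := H.truncMoment_one_le hq
  have h2 := H.tail_moment_le hq hqp le_rfl
  rw [Real.one_rpow] at h2
  rw [mul_add, mul_one, ← mul_div_assoc]
  linarith

theorem moment_two_le (H : DensityBounds p B b r x₀ h) (hp : p = 2) {q : ℝ} (hq : 0 ≤ q)
    (hqp : q < p) : ∫ u in Set.Ioi (0 : ℝ), u ^ q * h u ≤ 2 * B := by
  rw [H.moment_eq_add hq hqp zero_le_one]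
  have h1 := H.truncMoment_one_le hq
  have h2 := H.tail_moment_two_le hp hq hqp le_rfl
  rw [Real.one_rpow] at h2
  linarith

/-- For y ≤ 1, sin y ≥ 2y/π ≥ y/2, and (1/2)^q ≥ 1/4 because q ≤ 2. -/
theorem rpow_mul_truncMoment_le_sinIntegral (H : DensityBounds p B b r x₀ h) (hn : ∀ x, 0 ≤ h x)
    (hp : 0 < p) {q : ℝ} (hq : 0 ≤ q) (hq2 : q ≤ 2) {a : ℝ} (ha : 0 < a) :
    a ^ q * truncMoment h q (1 / a) ≤ 4 * sinIntegral h q a := by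
  have := H.mul_truncMoment_le_sinIntegral hn hp hq (a := a) (k := a ^ q / 4) (T := 1 / a)
    (by positivity) fun u hu hua => ?_
  · linarith
  have hau : a * u ≤ 1 := by rwa [le_div_iff₀' ha] at hua
  have hau0 : 0 < a * u := mul_pos ha hu
  have h1 : 1 / 2 * (a * u) ≤ |Real.sin (a * u)| := by
    have h1 := Real.mul_le_sin hau0.le (hau.trans Real.one_le_pi_div_two)
    have h2 : 1 / 2 ≤ 2 / Real.pi := by
      rw [div_le_div_iff₀ two_pos Real.pi_pos]; linarith [Real.pi_le_four]
    calc _ ≤ 2 / Real.pi * (a * u) := by gcongr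
      _ ≤ _ := h1.trans (le_abs_self _)
  calc a ^ q / 4 * u ^ q = (1 / 2 : ℝ) ^ (2 : ℝ) * (a * u) ^ q := by
        rw [Real.mul_rpow ha.le hu.le]; norm_num; ring
    _ ≤ (1 / 2 : ℝ) ^ q * (a * u) ^ q := by
        gcongr ?_ * _
        exact Real.rpow_le_rpow_of_exponent_ge (by norm_num) (by norm_num) hq2
    _ = (1 / 2 * (a * u)) ^ q := (Real.mul_rpow (by norm_num) hau0.le).symm
    _ ≤ _ := by gcongr

end DensityBounds

/-! ### Pointwise inequalities for powers of the sine. -/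

/-- A cubic lower bound for sine gives sin y ≥ (1 - ε/4) y; Bernoulli's inequality with q ≤ 2 turns
the loss into ε/2. -/
theorem one_sub_half_mul_rpow_le_sin_rpow {ε q y : ℝ} (hε1 : ε < 1 / 2) (hq : 1 ≤ q)
    (hq2 : q ≤ 2) (hy : 0 < y) (hyε : y ^ 2 ≤ ε) :
    (1 - ε / 2) * y ^ q ≤ |Real.sin y| ^ q := by
  have hε0 : 0 < ε := by nlinarith
  have h1 := Real.sin_gt_sub_cube hy
  have h2 : (1 - ε / 4) * y ≤ |Real.sin y| := by
    refine le_trans ?_ (le_abs_self _)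
    nlinarith
  calc (1 - ε / 2) * y ^ q ≤ (1 - ε / 4) ^ q * y ^ q := by
        gcongr
        have h3 := one_add_mul_self_le_rpow_one_add (s := -(ε / 4)) (by linarith) hq
        rw [← sub_eq_add_neg] at h3
        nlinarith
    _ = ((1 - ε / 4) * y) ^ q := (Real.mul_rpow (by linarith) hy.le).symm
    _ ≤ _ := Real.rpow_le_rpow (mul_nonneg (by linarith) hy.le) h2 (by linarith)

theorem abs_rpow_sub_rpow_le {q M α β : ℝ} (hq : 1 ≤ q) (hα : 0 ≤ α) (hαM : α ≤ M) (hβ : 0 ≤ β)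
    (hβM : β ≤ M) : |α ^ q - β ^ q| ≤ q * M ^ (q - 1) * |α - β| := by
  refine Convex.norm_image_sub_le_of_norm_hasDerivWithin_le (s := Set.Icc 0 M)
    (f := fun z : ℝ => z ^ q) (f' := fun z => q * z ^ (q - 1))
    (fun z _ => (Real.hasDerivAt_rpow_const (Or.inr hq)).hasDerivWithinAt) (fun z hz => ?_)
    (convex_Icc 0 M) ⟨hβ, hβM⟩ ⟨hα, hαM⟩
  have h0 := Real.rpow_nonneg hz.1 (q - 1)
  rw [Real.norm_of_nonneg (by positivity)]
  have h1 := Real.rpow_le_rpow hz.1 hz.2 (by linarith : 0 ≤ q - 1)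
  gcongr

theorem abs_abs_sin_sub_abs_sin_le (x y : ℝ) : abs (|Real.sin x| - |Real.sin y|) ≤ |x - y| := by
  exact (abs_abs_sub_abs_le_abs_sub _ _).trans (Real.abs_sin_sub_sin_le x y)

/-- The mean value bound on [0, 1]; being linear in y, it is the one used in the far range. -/
theorem abs_sin_rpow_sub_le {ε q y : ℝ} (hε0 : 0 < ε) (hq : 1 ≤ q) (hq2 : q ≤ 2) (hy : 0 < y) :
    abs (|Real.sin ((1 + ε) * y)| ^ q - |Real.sin y| ^ q) ≤ 2 * ε * y := by
  have h1 := abs_rpow_sub_rpow_le hq (abs_nonneg (Real.sin ((1 + ε) * y)))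
    (Real.abs_sin_le_one _) (abs_nonneg (Real.sin y)) (Real.abs_sin_le_one _)
  have h2 := abs_abs_sin_sub_abs_sin_le ((1 + ε) * y) y
  rw [show (1 + ε) * y - y = ε * y by ring, abs_of_pos (show 0 < ε * y by positivity)] at h2
  rw [Real.one_rpow, mul_one] at h1
  refine h1.trans ?_
  calc _ ≤ 2 * (ε * y) := by gcongr
    _ = _ := by ring

/-- Both sines are at most (3/2) y because ε < 1/2, so the mean value bound keeps the power y^q
needed in the near range; 3 is 2 · 3/2. -/
theorem abs_sin_rpow_sub_le_of_le_one {ε q y : ℝ} (hε0 : 0 < ε) (hε1 : ε < 1 / 2) (hq : 1 ≤ q)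
    (hq2 : q ≤ 2) (hy : 0 < y) :
    abs (|Real.sin ((1 + ε) * y)| ^ q - |Real.sin y| ^ q) ≤ 3 * ε * y ^ q := by
  have m1 : |Real.sin ((1 + ε) * y)| ≤ 3 / 2 * y := by
    refine Real.abs_sin_le_abs.trans ?_
    rw [abs_of_pos (by positivity)]; gcongr; linarith
  have m2 : |Real.sin y| ≤ 3 / 2 * y := by
    refine Real.abs_sin_le_abs.trans ?_
    rw [abs_of_pos hy]; linarith
  have h1 := abs_rpow_sub_rpow_le hq (abs_nonneg (Real.sin ((1 + ε) * y))) m1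
    (abs_nonneg (Real.sin y)) m2
  have h2 := abs_abs_sin_sub_abs_sin_le ((1 + ε) * y) y
  rw [show (1 + ε) * y - y = ε * y by ring, abs_of_pos (show 0 < ε * y by positivity)] at h2
  refine h1.trans ?_
  have h3 : (3 / 2 * y) ^ (q - 1) ≤ 3 / 2 * y ^ (q - 1) := by
    rw [Real.mul_rpow (by norm_num) hy.le]
    gcongr
    calc (3 / 2 : ℝ) ^ (q - 1) ≤ (3 / 2 : ℝ) ^ (1 : ℝ) :=
          Real.rpow_le_rpow_of_exponent_le (by norm_num) (by linarith)
      _ = 3 / 2 := Real.rpow_one _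
  have h4 : y ^ (q - 1) * y = y ^ q := by rw [← Real.rpow_add_one hy.ne']; ring_nf
  calc _ ≤ 2 * (3 / 2 * y ^ (q - 1)) * (ε * y) := by gcongr
    _ = 3 * ε * (y ^ (q - 1) * y) := by ring
    _ = _ := by rw [h4]

/-! ### Small scales, with cutoff √ε/a. -/

namespace DensityBounds

variable {p B b r x₀ : ℝ} {h : ℝ → ℝ}

theorem one_sub_mul_truncMoment_le_sinIntegral (H : DensityBounds p B b r x₀ h)
    (hn : ∀ x, 0 ≤ h x) (hp : 0 < p) {ε q a : ℝ} (hε0 : 0 < ε) (hε1 : ε < 1 / 2) (hq : 1 ≤ q)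
    (hq2 : q ≤ 2) (ha : 0 < a) :
    (1 - ε / 2) * (a ^ q * truncMoment h q (Real.sqrt ε / a)) ≤ sinIntegral h q a := by
  rw [← mul_assoc]
  refine H.mul_truncMoment_le_sinIntegral hn hp (by linarith) (by positivity) fun u hu huT => ?_
  rw [mul_assoc, ← Real.mul_rpow ha.le hu.le]
  have hau : 0 < a * u := mul_pos ha hu
  refine one_sub_half_mul_rpow_le_sin_rpow hε1 hq hq2 hau ?_
  rw [le_div_iff₀' ha] at huT
  calc (a * u) ^ 2 ≤ Real.sqrt ε ^ 2 := by gcongr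
    _ = ε := Real.sq_sqrt hε0.le

theorem sqrt_div_rpow_neg {ε a : ℝ} (hε0 : 0 < ε) (ha : 0 < a) (q : ℝ) :
    (Real.sqrt ε / a) ^ (-q) = a ^ q * ε ^ (-(q / 2)) := by
  rw [Real.div_rpow (Real.sqrt_nonneg _) ha.le, Real.rpow_neg ha.le, div_inv_eq_mul, mul_comm,
    Real.sqrt_eq_rpow, ← Real.rpow_mul hε0.le]
  ring_nf

theorem tail_two_sqrt_div_le (H : DensityBounds p B b r x₀ h) (hp : p = 2) {ε q a : ℝ}
    (hε0 : 0 < ε) (hε1 : ε < 1 / 2) (hq2 : q ≤ 2) (ha : 0 < a) (hT : 1 / ε ≤ Real.sqrt ε / a) :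
    ∫ u in Set.Ioi (Real.sqrt ε / a), h u ≤ B * ε * a ^ q := by
  have hB := H.upper_pos
  set T := Real.sqrt ε / a with hTdef
  have hT0 : 0 < T := by positivity
  have hT1 : 1 ≤ T := le_trans (by rw [le_div_iff₀ hε0]; linarith) hT
  refine (H.tail_two_le hp hT1).trans ?_
  have e1 : T ^ (-4 : ℝ) = T ^ (-q) * T ^ (-(4 - q)) := by
    rw [← Real.rpow_add hT0]; ring_nf
  have h1 : T ^ (-(4 - q)) ≤ ε ^ (4 - q) := by
    calc T ^ (-(4 - q)) ≤ (1 / ε) ^ (-(4 - q)) :=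
          Real.rpow_le_rpow_of_nonpos (by positivity) hT (by linarith)
      _ = ε ^ (4 - q) := by rw [one_div, Real.inv_rpow hε0.le, Real.rpow_neg hε0.le, inv_inv]
  rw [e1, sqrt_div_rpow_neg hε0 ha]
  -- The exponent 4 - 3q/2 is at least 1 exactly when q ≤ 2; this is why the tail at p = 2 is
  -- recorded with the power -5.
  have h2 : ε ^ (-(q / 2)) * ε ^ (4 - q) ≤ ε := by
    rw [← Real.rpow_add hε0]
    conv_rhs => rw [← Real.rpow_one ε]
    exact Real.rpow_le_rpow_of_exponent_ge hε0 (by linarith) (by linarith)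
  calc _ ≤ B * (a ^ q * ε ^ (-(q / 2)) * ε ^ (4 - q)) := by gcongr
    _ = B * (ε ^ (-(q / 2)) * ε ^ (4 - q)) * a ^ q := by ring
    _ ≤ _ := by gcongr

/-- Small scales, `q < p`. -/
theorem exists_sinIntegral_small_scale (H : DensityBounds p B b r x₀ h) (hp1 : 1 ≤ p)
    (hp2 : p ≤ 2) : ∃ C : ℝ, 0 < C ∧ ((∀ x, 0 ≤ h x) → ∀ q : ℝ, 1 ≤ q → q < p →
      ∀ ε : ℝ, 0 < ε → ε < 1 / 2 → ∀ a : ℝ, 0 < a →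
      a ≤ min (ε ^ (1 / 2 + 1 / (p - q)))
        (Real.sqrt ε * (1 + (p - q) * ε ^ (-(q / 2 + 1))) ^ (-(1 / (p - q)))) →
      (1 - C * ε) * (a ^ q * ∫ u in Set.Ioi (0 : ℝ), u ^ q * h u) ≤ sinIntegral h q a ∧
      sinIntegral h q a ≤ (1 + C * ε) * (a ^ q * ∫ u in Set.Ioi (0 : ℝ), u ^ q * h u)) := by
  have hr0 := H.radius_pos
  have hb := H.lower_pos
  have hB := H.upper_pos
  have hx0 : 0 < x₀ := by linarith [H.one_le]
  -- The first summand serves p < 2, the second p = 2, and the 1 covers the loss ε/2 from the sine.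
  refine ⟨B * (x₀ / b) + B * (3 / (b * r ^ 3)) + 1, by positivity,
    fun hn q hq hqp ε hε0 hε1 a ha hamin => ?_⟩
  set A := B * (x₀ / b) + B * (3 / (b * r ^ 3)) with hA
  have hA0 : 0 < A := by positivity
  obtain ⟨ha1, ha2⟩ := le_min_iff.1 hamin
  have hpq : 0 < p - q := by linarith
  have haq : 0 < a ^ q := Real.rpow_pos_of_pos ha q
  set M := ∫ u in Set.Ioi (0 : ℝ), u ^ q * h u with hM
  have hMlow := H.le_moment hn hp2 (by linarith : 0 ≤ q) hqp
  rw [← hM] at hMlow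
  have hM0 : 0 < M := lt_of_lt_of_le (by positivity) hMlow
  have hM1 : 1 ≤ 3 / (b * r ^ 3) * M := by
    calc (1 : ℝ) = 3 / (b * r ^ 3) * (b * r ^ 3 / 3) := by field_simp
      _ ≤ _ := by gcongr
  set T := Real.sqrt ε / a with hT
  have hT0 : 0 < T := by positivity
  have hT1 : ε ^ (-(1 / (p - q))) ≤ T := by
    rw [hT, le_div_iff₀ ha]
    calc _ ≤ ε ^ (-(1 / (p - q))) * ε ^ (1 / 2 + 1 / (p - q)) := by gcongr
      _ = Real.sqrt ε := by rw [← Real.rpow_add hε0, Real.sqrt_eq_rpow]; ring_nf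
  have hTε : 1 / ε ≤ T := by
    refine le_trans ?_ hT1
    rw [one_div, ← Real.rpow_neg_one]
    refine Real.rpow_le_rpow_of_exponent_ge hε0 (by linarith) (neg_le_neg ?_)
    rw [le_div_iff₀ hpq]; linarith
  have hTone : 1 ≤ T := le_trans (by rw [le_div_iff₀ hε0]; linarith) hTε
  -- The first bound on a: it controls the moment beyond T.
  have hTpq : T ^ (-(p - q)) ≤ ε := by
    calc T ^ (-(p - q)) ≤ (ε ^ (-(1 / (p - q)))) ^ (-(p - q)) :=
          Real.rpow_le_rpow_of_nonpos (by positivity) hT1 (by linarith)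
      _ = ε := by
          rw [← Real.rpow_mul hε0.le, neg_mul_neg, one_div_mul_cancel hpq.ne', Real.rpow_one]
  -- The second bound on a: it controls the mass beyond T, where T^(-p) = T^(-(p-q)) a^q ε^(-q/2)
  -- costs an extra ε^(-q/2).
  have hTpq2 : T ^ (-(p - q)) ≤ ε ^ (q / 2 + 1) / (p - q) := by
    set Z := 1 + (p - q) * ε ^ (-(q / 2 + 1)) with hZ
    have hε' : 0 < ε ^ (-(q / 2 + 1)) := Real.rpow_pos_of_pos hε0 _
    have hZ0 : 0 < Z := by positivity
    have hTZ : Z ^ (1 / (p - q)) ≤ T := by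
      rw [hT, le_div_iff₀ ha]
      calc _ ≤ Z ^ (1 / (p - q)) * (Real.sqrt ε * Z ^ (-(1 / (p - q)))) := by gcongr
        _ = Real.sqrt ε * (Z ^ (1 / (p - q)) * Z ^ (-(1 / (p - q)))) := by ring
        _ = Real.sqrt ε := by rw [← Real.rpow_add hZ0]; simp
    calc T ^ (-(p - q)) ≤ (Z ^ (1 / (p - q))) ^ (-(p - q)) :=
          Real.rpow_le_rpow_of_nonpos (by positivity) hTZ (by linarith)
      _ = Z⁻¹ := by
          rw [← Real.rpow_mul hZ0.le, mul_neg, one_div_mul_cancel hpq.ne', Real.rpow_neg_one]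
      _ ≤ ((p - q) * ε ^ (-(q / 2 + 1)))⁻¹ := by
          apply inv_anti₀ (by positivity); linarith
      _ = _ := by rw [Real.rpow_neg hε0.le, mul_inv, inv_inv]; field_simp
  -- For p < 2 the factor 1/(p-q) is absorbed by the full moment M; for p = 2 the lighter tail
  -- avoids it.
  have htail : ∫ u in Set.Ioi T, u ^ q * h u ≤ A * ε * M := by
    rcases hp2.lt_or_eq with hp | hp
    · have h1 := H.le_mul_moment hn hp hq hqp
      rw [← hM] at h1
      calc _ ≤ B * T ^ (-(p - q)) / (p - q) := H.tail_moment_le (by linarith) hqp hTone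
        _ ≤ B * ε / (p - q) := by gcongr
        _ = B * ε * (1 / (p - q)) := by ring
        _ ≤ B * ε * (x₀ / b * M) := by gcongr
        _ = B * (x₀ / b) * (ε * M) := by ring
        _ ≤ A * (ε * M) := by gcongr; rw [hA]; linarith [show 0 < B * (3 / (b * r ^ 3)) by positivity]
        _ = _ := by ring
    · calc _ ≤ B * T ^ (q - 4) := H.tail_moment_two_le hp (by linarith) hqp hTone
        _ ≤ B * T ^ (-(p - q)) := by
            have := Real.rpow_le_rpow_of_exponent_le hTone (by linarith : q - 4 ≤ -(p - q))
            gcongr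
        _ ≤ B * ε * 1 := by rw [mul_one]; gcongr
        _ ≤ B * ε * (3 / (b * r ^ 3) * M) := by gcongr
        _ = B * (3 / (b * r ^ 3)) * (ε * M) := by ring
        _ ≤ A * (ε * M) := by gcongr; rw [hA]; linarith [show 0 < B * (x₀ / b) by positivity]
        _ = _ := by ring
  have htail0 : ∫ u in Set.Ioi T, h u ≤ A * ε * (a ^ q * M) := by
    rcases hp2.lt_or_eq with hp | hp
    · have h1 := H.le_mul_moment hn hp hq hqp
      rw [← hM] at h1
      have e1 : T ^ (-p) = T ^ (-(p - q)) * T ^ (-q) := by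
        rw [← Real.rpow_add hT0]; ring_nf
      have e2 : ε ^ (q / 2 + 1) * ε ^ (-(q / 2)) = ε := by
        rw [← Real.rpow_add hε0]; ring_nf; exact Real.rpow_one ε
      calc _ ≤ B * T ^ (-p) := H.tail_le hp1 hTone
        _ = B * (T ^ (-(p - q)) * (a ^ q * ε ^ (-(q / 2)))) := by
            rw [e1, ← sqrt_div_rpow_neg hε0 ha]
        _ ≤ B * (ε ^ (q / 2 + 1) / (p - q) * (a ^ q * ε ^ (-(q / 2)))) := by gcongr
        _ = B * (ε ^ (q / 2 + 1) * ε ^ (-(q / 2))) * a ^ q * (1 / (p - q)) := by ring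
        _ = B * ε * a ^ q * (1 / (p - q)) := by rw [e2]
        _ ≤ B * ε * a ^ q * (x₀ / b * M) := by gcongr
        _ = B * (x₀ / b) * (ε * (a ^ q * M)) := by ring
        _ ≤ A * (ε * (a ^ q * M)) := by
            gcongr; rw [hA]; linarith [show 0 < B * (3 / (b * r ^ 3)) by positivity]
        _ = _ := by ring
    · calc _ ≤ B * ε * a ^ q := H.tail_two_sqrt_div_le hp hε0 hε1 (by linarith) ha hTε
        _ = B * ε * a ^ q * 1 := by ring
        _ ≤ B * ε * a ^ q * (3 / (b * r ^ 3) * M) := by gcongr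
        _ = B * (3 / (b * r ^ 3)) * (ε * (a ^ q * M)) := by ring
        _ ≤ A * (ε * (a ^ q * M)) := by
            gcongr; rw [hA]; linarith [show 0 < B * (x₀ / b) by positivity]
        _ = _ := by ring
  have hsplit := H.moment_eq_add (by linarith : 0 ≤ q) hqp hT0.le
  rw [← hM] at hsplit
  have htail_nonneg : 0 ≤ ∫ u in Set.Ioi T, u ^ q * h u :=
    setIntegral_nonneg measurableSet_Ioi fun u hu =>
      mul_nonneg (Real.rpow_nonneg (hT0.trans hu).le _) (hn u)
  have hlow := H.one_sub_mul_truncMoment_le_sinIntegral hn (by linarith) hε0 hε1 hq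
    (by linarith) ha
  have hup := H.sinIntegral_le hn (by linarith) (by linarith : 0 ≤ q) ha hT0.le
  rw [← hT] at hlow
  have hW : truncMoment h q T = M - ∫ u in Set.Ioi T, u ^ q * h u := by linarith
  rw [hW] at hlow hup
  set t := ∫ u in Set.Ioi T, u ^ q * h u
  have h1 : a ^ q * t ≤ a ^ q * (A * ε * M) := by gcongr
  have h2 : 0 ≤ a ^ q * t := by positivity
  have h3 : 0 ≤ ε * (a ^ q * M) := by positivity
  have h4 : 0 ≤ ε * (a ^ q * t) := by positivity
  constructor <;> linarith

/-- Small scales, `q = p`. -/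
theorem exists_sinIntegral_small_scale_self (H : DensityBounds p B b r x₀ h) (hp1 : 1 ≤ p)
    (hp2 : p ≤ 2) : ∃ C : ℝ, 0 < C ∧ ((∀ x, 0 ≤ h x) →
      ∀ ε : ℝ, 0 < ε → ε < 1 / 2 → ∀ a : ℝ, 0 < a →
      a ≤ Real.sqrt ε * Real.exp (-(ε ^ (-(p / 2 + 1)))) →
      0 < truncMoment h p (Real.sqrt ε / a) ∧
      (1 - C * ε) * (a ^ p * truncMoment h p (Real.sqrt ε / a)) ≤ sinIntegral h p a ∧
      sinIntegral h p a ≤ (1 + C * ε) * (a ^ p * truncMoment h p (Real.sqrt ε / a))) := by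
  have hr0 := H.radius_pos
  have hb := H.lower_pos
  have hB := H.upper_pos
  obtain ⟨A₁, hA₁, hV⟩ : ∃ A : ℝ, 0 < A ∧ (p < 2 → (∀ x, 0 ≤ h x) → ∀ q R : ℝ, 0 ≤ q → q ≤ p →
      1 ≤ R → 1 + modelMoment p q R ≤ A * truncMoment h q R) := by
    rcases hp2.lt_or_eq with hp | hp
    · obtain ⟨A, hA, hV⟩ := H.exists_one_add_modelMoment_le hp
      exact ⟨A, hA, fun _ => hV⟩
    · exact ⟨1, one_pos, fun h => absurd hp h.ne⟩
  refine ⟨B * A₁ + B * (3 / (b * r ^ 3)) + 1, by positivity, fun hn ε hε0 hε1 a ha haT => ?_⟩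
  set A := B * A₁ + B * (3 / (b * r ^ 3)) with hA
  have hap : 0 < a ^ p := Real.rpow_pos_of_pos ha p
  set T := Real.sqrt ε / a with hT
  have hT0 : 0 < T := by positivity
  set L := ε ^ (-(p / 2 + 1)) with hL
  have hL0 : 0 < L := Real.rpow_pos_of_pos hε0 _
  have hTL : Real.exp L ≤ T := by
    rw [hT, le_div_iff₀ ha]
    calc _ ≤ Real.exp L * (Real.sqrt ε * Real.exp (-L)) := by gcongr
      _ = Real.sqrt ε * (Real.exp L * Real.exp (-L)) := by ring
      _ = Real.sqrt ε := by rw [← Real.exp_add]; simp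
  have hlog : L ≤ Real.log T := by rwa [Real.le_log_iff_exp_le hT0]
  have hLε : 1 / ε ≤ L := by
    rw [hL, one_div, ← Real.rpow_neg_one]
    exact Real.rpow_le_rpow_of_exponent_ge hε0 (by linarith) (by linarith)
  have hTε : 1 / ε ≤ T := by linarith [Real.add_one_le_exp L]
  have hTone : 1 ≤ T := le_trans (by rw [le_div_iff₀ hε0]; linarith) hTε
  set W := truncMoment h p T with hW
  have hWlow := H.le_truncMoment hn (by linarith : 0 ≤ p) hp2 hTone
  rw [← hW] at hWlow
  have hW0 : 0 < W := lt_of_lt_of_le (by positivity) hWlow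
  have hW1 : 1 ≤ 3 / (b * r ^ 3) * W := by
    calc (1 : ℝ) = 3 / (b * r ^ 3) * (b * r ^ 3 / 3) := by field_simp
      _ ≤ _ := by gcongr
  have htail0 : ∫ u in Set.Ioi T, h u ≤ A * ε * (a ^ p * W) := by
    rcases hp2.lt_or_eq with hp | hp
    · have h1 := hV hp hn p T (by linarith) le_rfl hTone
      rw [modelMoment_self p hTone] at h1
      -- The exponent in L is chosen for this identity: the mass beyond T is O(a^p ε L), and L ≤ log
      -- T is dominated by the truncated moment.
      have e2 : ε ^ (-(p / 2)) = ε * L := by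
        rw [hL]
        conv_rhs => rw [← Real.rpow_one_add' hε0.le (by linarith)]
        ring_nf
      calc _ ≤ B * T ^ (-p) := H.tail_le hp1 hTone
        _ = B * (a ^ p * (ε * L)) := by rw [hT, sqrt_div_rpow_neg hε0 ha, e2]
        _ ≤ B * (a ^ p * (ε * (A₁ * W))) := by gcongr; linarith
        _ = B * A₁ * (ε * (a ^ p * W)) := by ring
        _ ≤ A * (ε * (a ^ p * W)) := by
            gcongr; rw [hA]; linarith [show 0 < B * (3 / (b * r ^ 3)) by positivity]
        _ = _ := by ring
    · calc _ ≤ B * ε * a ^ p := H.tail_two_sqrt_div_le hp hε0 hε1 hp2 ha hTε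
        _ = B * ε * a ^ p * 1 := by ring
        _ ≤ B * ε * a ^ p * (3 / (b * r ^ 3) * W) := by gcongr
        _ = B * (3 / (b * r ^ 3)) * (ε * (a ^ p * W)) := by ring
        _ ≤ A * (ε * (a ^ p * W)) := by
            gcongr; rw [hA]; linarith [show 0 < B * A₁ by positivity]
        _ = _ := by ring
  have hlow := H.one_sub_mul_truncMoment_le_sinIntegral hn (by linarith) hε0 hε1 hp1 hp2 ha
  have hup := H.sinIntegral_le hn (by linarith) (by linarith : 0 ≤ p) ha hT0.le
  rw [← hT, ← hW] at hlow
  rw [← hW] at hup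
  have h3 : 0 ≤ ε * (a ^ p * W) := by positivity
  have hA0 : 0 < A := by positivity
  have h4 : 0 ≤ A * (ε * (a ^ p * W)) := by positivity
  refine ⟨hW0, ?_, ?_⟩ <;> linarith

end DensityBounds

/-! ### Intermediate scales, with cutoff 1/a. -/

namespace DensityBounds

variable {p B b r x₀ : ℝ} {h : ℝ → ℝ}

/-- The mass beyond 1/a is at most B a^p, hence at most B a^q as a ≤ 1. -/
theorem sinIntegral_le_inv_scale (H : DensityBounds p B b r x₀ h) (hn : ∀ x, 0 ≤ h x)
    (hp1 : 1 ≤ p) {q a : ℝ} (hq : 0 ≤ q) (hqp : q ≤ p) (ha : 0 < a) (ha1 : a ≤ 1) :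
    sinIntegral h q a ≤ (truncMoment h q (1 / a) + B) * a ^ q := by
  have hB := H.upper_pos
  have hR : 1 ≤ 1 / a := by rw [le_div_iff₀ ha]; linarith
  have h1 := H.sinIntegral_le hn (by linarith) hq ha (zero_le_one.trans hR)
  have h2 := H.tail_le hp1 hR
  have h3 : (1 / a) ^ (-p) = a ^ p := by
    rw [one_div, Real.inv_rpow ha.le, Real.rpow_neg ha.le, inv_inv]
  have h4 : a ^ p ≤ a ^ q := Real.rpow_le_rpow_of_exponent_ge ha ha1 hqp
  rw [h3] at h2
  have h5 : B * a ^ p ≤ B * a ^ q := by gcongr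
  linarith

/-- Intermediate scales, upper bound for `q < p`. -/
theorem exists_sinIntegral_le (H : DensityBounds p B b r x₀ h) (hp1 : 1 ≤ p) (hp2 : p ≤ 2) :
    ∃ C : ℝ, 0 < C ∧ ((∀ x, 0 ≤ h x) → ∀ q : ℝ, 1 ≤ q → q < p → ∀ a : ℝ, 0 < a → a < 1 →
      sinIntegral h q a
        ≤ C * ((1 + (1 - a ^ (p - q)) * (∫ u in Set.Ioi (0 : ℝ), u ^ q * h u)) * a ^ q)) := by
  have hr0 := H.radius_pos
  have hb := H.lower_pos
  have hB := H.upper_pos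
  have hx0 : 0 < x₀ := by linarith [H.one_le]
  refine ⟨2 * B * (1 + x₀ / b) + 3 * B, by positivity, fun hn q hq hqp a ha ha1 => ?_⟩
  set M := ∫ u in Set.Ioi (0 : ℝ), u ^ q * h u with hM
  have hpq : 0 < p - q := by linarith
  have hR : 1 ≤ 1 / a := by rw [le_div_iff₀ ha]; linarith
  have hδ : 0 ≤ 1 - a ^ (p - q) := by
    linarith [Real.rpow_le_one ha.le ha1.le hpq.le]
  have hM0 : 0 ≤ M := le_trans (by positivity) (H.le_moment hn hp2 (by linarith : 0 ≤ q) hqp)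
  have hup := H.sinIntegral_le_inv_scale hn hp1 (by linarith : 0 ≤ q) hqp.le ha ha1.le
  have haq : 0 < a ^ q := Real.rpow_pos_of_pos ha q
  refine hup.trans ?_
  rw [← mul_assoc]
  refine mul_le_mul_of_nonneg_right ?_ haq.le
  set δ := 1 - a ^ (p - q) with hδdef
  have hδM : 0 ≤ δ * M := by positivity
  rcases hp2.lt_or_eq with hp | hp
  · have h1 := H.le_mul_moment hn hp hq hqp
    rw [← hM] at h1
    have h2 := H.truncMoment_le (by linarith : 0 ≤ q) hR
    have h3 : (1 / a) ^ (-(p - q)) = a ^ (p - q) := by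
      rw [one_div, Real.inv_rpow ha.le, Real.rpow_neg ha.le, inv_inv]
    rw [modelMoment_of_lt hqp hR, h3, ← hδdef] at h2
    -- The model moment at 1/a is δ/(p-q), and 1/(p-q) is at most a multiple of M.
    have h4 : δ / (p - q) ≤ x₀ / b * (δ * M) := by
      calc δ / (p - q) = δ * (1 / (p - q)) := by ring
        _ ≤ δ * (x₀ / b * M) := by gcongr
        _ = _ := by ring
    have h5 : 0 ≤ x₀ / b := by positivity
    have h6 : B * (1 + δ / (p - q)) ≤ B * (1 + x₀ / b * (δ * M)) := by gcongr
    nlinarith [mul_nonneg hB.le hδM, mul_nonneg hB.le h5, mul_nonneg (mul_nonneg hB.le h5) hδM]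
  · have h2 := H.truncMoment_two_le hp (by linarith : 0 ≤ q) hqp.le hR
    have h5 : 0 ≤ x₀ / b := by positivity
    nlinarith [mul_nonneg hB.le hδM, mul_nonneg hB.le h5, mul_nonneg (mul_nonneg hB.le h5) hδM]

/-- Intermediate scales, lower bound for `q < p`. -/
theorem exists_le_sinIntegral (H : DensityBounds p B b r x₀ h) (hp2 : p ≤ 2) :
    ∃ C : ℝ, 0 < C ∧ ((∀ x, 0 ≤ h x) → ∀ q : ℝ, 1 ≤ q → q < p → ∀ a : ℝ, 0 < a → a < 1 →
      (1 + (1 - a ^ (p - q)) * (∫ u in Set.Ioi (0 : ℝ), u ^ q * h u)) * a ^ q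
        ≤ C * sinIntegral h q a) := by
  have hr0 := H.radius_pos
  have hb := H.lower_pos
  have hB := H.upper_pos
  obtain ⟨A₁, hA₁, hV⟩ : ∃ A : ℝ, 0 < A ∧ (p < 2 → (∀ x, 0 ≤ h x) → ∀ q R : ℝ, 0 ≤ q → q ≤ p →
      1 ≤ R → 1 + modelMoment p q R ≤ A * truncMoment h q R) := by
    rcases hp2.lt_or_eq with hp | hp
    · obtain ⟨A, hA, hV⟩ := H.exists_one_add_modelMoment_le hp
      exact ⟨A, hA, fun _ => hV⟩
    · exact ⟨1, one_pos, fun h => absurd hp h.ne⟩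
  set A := (1 + 2 * B) * (A₁ + 3 / (b * r ^ 3)) with hA
  have hA0 : 0 < A := by positivity
  refine ⟨A * 4, by positivity, fun hn q hq hqp a ha ha1 => ?_⟩
  set M := ∫ u in Set.Ioi (0 : ℝ), u ^ q * h u with hM
  have hpq : 0 < p - q := by linarith
  have hR : 1 ≤ 1 / a := by rw [le_div_iff₀ ha]; linarith
  have hδ : 0 ≤ 1 - a ^ (p - q) := by
    linarith [Real.rpow_le_one ha.le ha1.le hpq.le]
  have hδ1 : 1 - a ^ (p - q) ≤ 1 := by linarith [Real.rpow_nonneg ha.le (p - q)]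
  set δ := 1 - a ^ (p - q) with hδdef
  have haq : 0 < a ^ q := Real.rpow_pos_of_pos ha q
  set W := truncMoment h q (1 / a) with hW
  have hWlow := H.le_truncMoment hn (by linarith : 0 ≤ q) (by linarith) hR
  rw [← hW] at hWlow
  have hW0 : 0 < W := lt_of_lt_of_le (by positivity) hWlow
  have key : 1 + δ * M ≤ A * W := by
    rcases hp2.lt_or_eq with hp | hp
    · have h1 := hV hp hn q (1 / a) (by linarith) hqp.le hR
      have h3 : (1 / a) ^ (-(p - q)) = a ^ (p - q) := by
        rw [one_div, Real.inv_rpow ha.le, Real.rpow_neg ha.le, inv_inv]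
      rw [modelMoment_of_lt hqp hR, h3, ← hδdef] at h1
      have h2 := H.moment_le (by linarith : 0 ≤ q) hqp
      rw [← hM] at h2
      -- Thus M ≤ 2B/(p-q), and δM is at most a multiple of the model moment δ/(p-q).
      have h4 : 1 ≤ 1 / (p - q) := by rw [le_div_iff₀ hpq]; linarith
      have h5 : 0 ≤ δ / (p - q) := by positivity
      calc 1 + δ * M ≤ 1 + δ * (B * (1 / (p - q) + 1 / (p - q))) := by
            gcongr; exact h2.trans (by gcongr)
        _ = 1 + 2 * B * (δ / (p - q)) := by ring
        _ ≤ (1 + 2 * B) * (1 + δ / (p - q)) := by nlinarith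
        _ ≤ (1 + 2 * B) * (A₁ * W) := by gcongr
        _ = (1 + 2 * B) * A₁ * W := by ring
        _ ≤ (1 + 2 * B) * (A₁ + 3 / (b * r ^ 3)) * W := by
            gcongr; linarith [show 0 < 3 / (b * r ^ 3) by positivity]
    · have h2 := H.moment_two_le hp (by linarith : 0 ≤ q) hqp
      rw [← hM] at h2
      have hW1 : 1 ≤ 3 / (b * r ^ 3) * W := by
        calc (1 : ℝ) = 3 / (b * r ^ 3) * (b * r ^ 3 / 3) := by field_simp
          _ ≤ _ := by gcongr
      have hM0 : 0 ≤ M := le_trans (by positivity) (H.le_moment hn hp2 (by linarith : 0 ≤ q) hqp)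
      calc 1 + δ * M ≤ 1 + 1 * (2 * B) := by gcongr
        _ = (1 + 2 * B) * 1 := by ring
        _ ≤ (1 + 2 * B) * (3 / (b * r ^ 3) * W) := by gcongr
        _ = (1 + 2 * B) * (3 / (b * r ^ 3)) * W := by ring
        _ ≤ (1 + 2 * B) * (A₁ + 3 / (b * r ^ 3)) * W := by gcongr; linarith
  have hlow := H.rpow_mul_truncMoment_le_sinIntegral hn (by linarith) (by linarith : 0 ≤ q)
    (by linarith) ha
  calc _ ≤ A * W * a ^ q := by gcongr
    _ = A * (a ^ q * W) := by ring
    _ ≤ A * (4 * sinIntegral h q a) := by gcongr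
    _ = _ := by ring

/-- Intermediate scales, upper bound for `q = p`. -/
theorem sinIntegral_self_le (H : DensityBounds p B b r x₀ h) (hn : ∀ x, 0 ≤ h x) (hp1 : 1 ≤ p)
    {a : ℝ} (ha : 0 < a) (ha1 : a < 1) :
    sinIntegral h p a ≤ 2 * B * ((1 + Real.log (1 / a)) * a ^ p) := by
  have hB := H.upper_pos
  have hR : 1 ≤ 1 / a := by rw [le_div_iff₀ ha]; linarith
  have hup := H.sinIntegral_le_inv_scale hn hp1 (by linarith : 0 ≤ p) le_rfl ha ha1.le
  have h2 := H.truncMoment_le (by linarith : 0 ≤ p) hR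
  rw [modelMoment_self p hR] at h2
  have hl := Real.log_nonneg hR
  have haq : 0 < a ^ p := Real.rpow_pos_of_pos ha p
  refine hup.trans ?_
  rw [← mul_assoc]
  refine mul_le_mul_of_nonneg_right ?_ haq.le
  nlinarith

/-- Intermediate scales, lower bound for `q = p < 2`. -/
theorem exists_le_sinIntegral_self (H : DensityBounds p B b r x₀ h) (hp1 : 1 ≤ p) (hp2 : p < 2) :
    ∃ C : ℝ, 0 < C ∧ ((∀ x, 0 ≤ h x) → ∀ a : ℝ, 0 < a → a < 1 →
      (1 + Real.log (1 / a)) * a ^ p ≤ C * sinIntegral h p a) := by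
  obtain ⟨A, hA, hV⟩ := H.exists_one_add_modelMoment_le hp2
  refine ⟨A * 4, by positivity, fun hn a ha ha1 => ?_⟩
  have hR : 1 ≤ 1 / a := by rw [le_div_iff₀ ha]; linarith
  have h1 := hV hn p (1 / a) (by linarith) le_rfl hR
  rw [modelMoment_self p hR] at h1
  have hlow := H.rpow_mul_truncMoment_le_sinIntegral hn (by linarith) (by linarith : 0 ≤ p)
    hp2.le ha
  have haq : 0 < a ^ p := Real.rpow_pos_of_pos ha p
  calc _ ≤ A * truncMoment h p (1 / a) * a ^ p := by gcongr
    _ = A * (a ^ p * truncMoment h p (1 / a)) := by ring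
    _ ≤ A * (4 * sinIntegral h p a) := by gcongr
    _ = _ := by ring

theorem sinIntegral_pos (H : DensityBounds p B b r x₀ h) (hn : ∀ x, 0 ≤ h x) (hp1 : 1 ≤ p)
    {q a : ℝ} (hq : 0 ≤ q) (hq2 : q ≤ 2) (ha : 0 < a) (ha1 : a ≤ 1) : 0 < sinIntegral h q a := by
  have hr0 := H.radius_pos
  have hb := H.lower_pos
  have hR : 1 ≤ 1 / a := by rw [le_div_iff₀ ha]; linarith
  have h1 := H.rpow_mul_truncMoment_le_sinIntegral hn (by linarith) hq hq2 ha
  have h2 : 0 < truncMoment h q (1 / a) :=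
    lt_of_lt_of_le (by positivity) (H.le_truncMoment hn hq hq2 hR)
  have : 0 < a ^ q * truncMoment h q (1 / a) := mul_pos (Real.rpow_pos_of_pos ha q) h2
  linarith

/-! ### Smoothness for p > 1. -/

/-- Smoothness, `1 < p`. -/
theorem exists_abs_sinIntegral_sub_le (H : DensityBounds p B b r x₀ h) (hp1 : 1 < p) (hp2 : p ≤ 2) :
    ∃ C : ℝ, 0 < C ∧ ((∀ x, 0 ≤ h x) → ∀ q : ℝ, 1 ≤ q → q ≤ p → ∀ ε : ℝ, 0 < ε → ε < 1 / 2 →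
      ∀ a : ℝ, 0 < a → a ≤ 1 →
      |sinIntegral h q ((1 + ε) * a) - sinIntegral h q a| ≤ C * ε * sinIntegral h q a) := by
  have hr0 := H.radius_pos
  have hb := H.lower_pos
  have hB := H.upper_pos
  have hp0 : 0 < p - 1 := by linarith
  set A := 2 * B / (p - 1) * (3 / (b * r ^ 3)) with hA
  have hA0 : 0 < A := by positivity
  refine ⟨(3 + A) * 4, by positivity, fun hn q hq hqp ε hε0 hε1 a ha ha1 => ?_⟩
  have hq0 : 0 ≤ q := by linarith
  have hR : 1 ≤ 1 / a := by rw [le_div_iff₀ ha]; linarith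
  have hR0 : 0 ≤ 1 / a := by linarith
  set W := truncMoment h q (1 / a) with hW
  have hWlow := H.le_truncMoment hn hq0 (by linarith) hR
  rw [← hW] at hWlow
  have hW0 : 0 < W := lt_of_lt_of_le (by positivity) hWlow
  have hW1 : 1 ≤ 3 / (b * r ^ 3) * W := by
    calc (1 : ℝ) = 3 / (b * r ^ 3) * (b * r ^ 3 / 3) := by field_simp
      _ ≤ _ := by gcongr
  have haq : 0 < a ^ q := Real.rpow_pos_of_pos ha q
  have ih : IntegrableOn h (Set.Ioi 0) := H.integrableOn (by linarith) le_rfl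
  have ihR : IntegrableOn h (Set.Ioi (1 / a)) := H.integrableOn (by linarith) hR0
  have ihT : IntegrableOn h (Set.Ioc 0 (1 / a)) := ih.mono_set Set.Ioc_subset_Ioi_self
  have hnear : |(∫ u in Set.Ioc 0 (1 / a), |Real.sin ((1 + ε) * a * u)| ^ q * h u)
      - ∫ u in Set.Ioc 0 (1 / a), |Real.sin (a * u)| ^ q * h u| ≤ 3 * ε * a ^ q * W := by
    rw [← integral_sub (integrableOn_abs_sin_rpow_mul ihT hq0 _)
      (integrableOn_abs_sin_rpow_mul ihT hq0 _), hW]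
    unfold truncMoment
    rw [← integral_const_mul, ← Real.norm_eq_abs]
    refine norm_integral_le_of_norm_le ((H.integrableOn_rpow_mul_Ioc hq0 0 (1 / a)).const_mul _)
      ((ae_restrict_iff' measurableSet_Ioc).2 (Filter.Eventually.of_forall fun u hu => ?_))
    have h1 := abs_sin_rpow_sub_le_of_le_one hε0 hε1 hq (by linarith) (mul_pos ha hu.1)
    rw [← sub_mul, norm_mul, Real.norm_of_nonneg (hn u), Real.norm_eq_abs, mul_assoc (1 + ε)]
    calc _ ≤ 3 * ε * (a * u) ^ q * h u := mul_le_mul_of_nonneg_right h1 (hn u)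
      _ = _ := by rw [Real.mul_rpow ha.le hu.1.le]; ring
  have hfar : |(∫ u in Set.Ioi (1 / a), |Real.sin ((1 + ε) * a * u)| ^ q * h u)
      - ∫ u in Set.Ioi (1 / a), |Real.sin (a * u)| ^ q * h u|
      ≤ 2 * ε * a * ∫ u in Set.Ioi (1 / a), u ^ (1 : ℝ) * h u := by
    rw [← integral_sub (integrableOn_abs_sin_rpow_mul ihR hq0 _)
      (integrableOn_abs_sin_rpow_mul ihR hq0 _), ← integral_const_mul, ← Real.norm_eq_abs]
    refine norm_integral_le_of_norm_le ((H.integrableOn_rpow_mul zero_le_one hp1 hR0).const_mul _)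
      ((ae_restrict_iff' measurableSet_Ioi).2 (Filter.Eventually.of_forall fun u hu => ?_))
    have hu0 : 0 < u := lt_of_le_of_lt hR0 hu
    have h1 := abs_sin_rpow_sub_le hε0 hq (by linarith) (mul_pos ha hu0)
    rw [← sub_mul, norm_mul, Real.norm_of_nonneg (hn u), Real.norm_eq_abs, mul_assoc (1 + ε)]
    calc _ ≤ 2 * ε * (a * u) * h u := mul_le_mul_of_nonneg_right h1 (hn u)
      _ = _ := by rw [Real.rpow_one]; ring
  -- The first moment of the tail is finite only because p > 1; the constant degenerates as p tends
  -- to 1.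
  have htail : a * ∫ u in Set.Ioi (1 / a), u ^ (1 : ℝ) * h u ≤ B / (p - 1) * a ^ q := by
    have h1 := H.tail_moment_le zero_le_one hp1 hR
    have h3 : a * (1 / a) ^ (-(p - 1)) = a ^ p := by
      rw [one_div, Real.inv_rpow ha.le, Real.rpow_neg ha.le, inv_inv,
        ← Real.rpow_one_add' ha.le (by linarith)]
      ring_nf
    have h4 : a ^ p ≤ a ^ q := Real.rpow_le_rpow_of_exponent_ge ha ha1 hqp
    calc _ ≤ a * (B * (1 / a) ^ (-(p - 1)) / (p - 1)) := by gcongr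
      _ = B / (p - 1) * (a * (1 / a) ^ (-(p - 1))) := by ring
      _ ≤ B / (p - 1) * a ^ q := by rw [h3]; gcongr
  have hlow := H.rpow_mul_truncMoment_le_sinIntegral hn (by linarith) hq0 (by linarith) ha
  rw [H.sinIntegral_eq_add (by linarith) hq0 ((1 + ε) * a) hR0,
    H.sinIntegral_eq_add (by linarith) hq0 a hR0, add_sub_add_comm]
  -- The preceding rewrite also split the right-hand side; this restores it.
  rw [← H.sinIntegral_eq_add (by linarith) hq0 a hR0]
  refine (abs_add_le _ _).trans ((add_le_add hnear hfar).trans ?_)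
  calc _ = 3 * ε * a ^ q * W + 2 * ε * (a * ∫ u in Set.Ioi (1 / a), u ^ (1 : ℝ) * h u) := by ring
    _ ≤ 3 * ε * a ^ q * W + 2 * ε * (B / (p - 1) * (a ^ q * 1)) := by rw [mul_one]; gcongr
    _ ≤ 3 * ε * a ^ q * W + 2 * ε * (B / (p - 1) * (a ^ q * (3 / (b * r ^ 3) * W))) := by gcongr
    _ = (3 + A) * ε * (a ^ q * W) := by rw [hA]; ring
    _ ≤ (3 + A) * ε * (4 * sinIntegral h q a) := by gcongr
    _ = _ := by ring

end DensityBounds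

/-! ### From the density to the random variable. -/

theorem integral_withDensity_stableDensity {p : ℝ} (hp : 0 < p) (hn : ∀ x, 0 ≤ stableDensity p x)
    (f : ℝ → ℝ) :
    ∫ x, f x ∂(volume.withDensity fun x => ENNReal.ofReal (stableDensity p x))
      = ∫ x, f x * stableDensity p x := by
  rw [integral_withDensity_eq_integral_toReal_smul
    (continuous_stableDensity hp).measurable.ennreal_ofReal
    (Filter.Eventually.of_forall fun x => ENNReal.ofReal_lt_top)]
  congr 1; ext x
  rw [ENNReal.toReal_ofReal (hn x), smul_eq_mul, mul_comm]

theorem integral_stableDensity {p : ℝ} (hp1 : 1 ≤ p) (hp2 : p ≤ 2) :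
    ∫ x, stableDensity p x = 1 := by
  have h := integral_cos_mul_stableDensity hp1 hp2 0
  rw [abs_zero, Real.zero_rpow (by linarith)] at h
  simpa using h

/-- The stable density is nonnegative: it has total mass one, and so has its positive part. -/
theorem IsSymmetricStable.stableDensity_nonneg {Ω : Type*} [MeasurableSpace Ω] {P : Measure Ω}
    [IsProbabilityMeasure P] {g : Ω → ℝ} {p : ℝ} (hp1 : 1 ≤ p) (hp2 : p ≤ 2)
    (hg : IsSymmetricStable p g P) (x : ℝ) : 0 ≤ stableDensity p x := by
  have hp0 : 0 < p := by linarith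
  have hi := integrable_stableDensity hp1 hp2
  have hlaw : HasLaw g (volume.withDensity fun x => ENNReal.ofReal (stableDensity p x)) P := hg
  have hpos : ∫⁻ x, ENNReal.ofReal (stableDensity p x) = 1 := by
    have h1 : IsProbabilityMeasure (P.map g) := Measure.isProbabilityMeasure_map hlaw.aemeasurable
    rw [hlaw.map_eq] at h1
    have := h1.measure_univ
    rwa [withDensity_apply _ MeasurableSet.univ, Measure.restrict_univ] at this
  have h2 := integral_eq_lintegral_pos_part_sub_lintegral_neg_part hi
  rw [integral_stableDensity hp1 hp2, hpos, ENNReal.toReal_one] at h2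
  have h3 : (∫⁻ x, ENNReal.ofReal (-stableDensity p x)).toReal = 0 := by linarith
  have hfin : ∫⁻ x, ENNReal.ofReal (-stableDensity p x) ≠ ⊤ := hi.neg.lintegral_lt_top.ne
  have h4 := ((ENNReal.toReal_eq_zero_iff _).1 h3).resolve_right hfin
  have hm : Continuous fun x => ENNReal.ofReal (-stableDensity p x) :=
    ENNReal.continuous_ofReal.comp (continuous_stableDensity hp0).neg
  rw [lintegral_eq_zero_iff hm.measurable] at h4
  -- Continuity upgrades almost everywhere to everywhere.
  have h5 := congrFun ((hm.ae_eq_iff_eq volume continuous_const).1 h4) x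
  simpa using h5

section Moments

variable {Ω : Type*} [MeasurableSpace Ω] {P : Measure Ω} {g : Ω → ℝ} {p : ℝ}

theorem IsSymmetricStable.sineMoment_eq_integral (hp : 0 < p) (hg : IsSymmetricStable p g P)
    (hn : ∀ x, 0 ≤ stableDensity p x) {q : ℝ} (hq : 0 ≤ q) (a : ℝ) :
    sineMoment P g q a = ∫ x, |Real.sin (a * x)| ^ q * stableDensity p x := by
  have hlaw : HasLaw g (volume.withDensity fun x => ENNReal.ofReal (stableDensity p x)) P := hg
  rw [← integral_withDensity_stableDensity hp hn]
  exact hlaw.integral_comp (continuous_abs_sin_rpow hq a).aestronglyMeasurable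

theorem IsSymmetricStable.sineMoment_eq (hp : 0 < p) (hg : IsSymmetricStable p g P)
    (hn : ∀ x, 0 ≤ stableDensity p x) {q : ℝ} (hq : 0 ≤ q) (a : ℝ) :
    sineMoment P g q a = 2 * sinIntegral (stableDensity p) q a := by
  rw [hg.sineMoment_eq_integral hp hn hq]
  unfold sinIntegral
  rw [← integral_comp_abs (f := fun u => |Real.sin (a * u)| ^ q * stableDensity p u)]
  congr 1; ext x
  rw [stableDensity_abs]
  rcases abs_choice x with h | h <;> rw [h]
  rw [mul_neg, Real.sin_neg, abs_neg]

theorem sineMoment_le_one [IsProbabilityMeasure P] {q : ℝ} (hq : 0 ≤ q) (a : ℝ) :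
    sineMoment P g q a ≤ 1 := by
  have h1 : ∫ _ : Ω, (1 : ℝ) ∂P = 1 := by simp
  rw [← h1]
  exact integral_mono_of_nonneg
    (Filter.Eventually.of_forall fun ω => Real.rpow_nonneg (abs_nonneg _) _)
    (integrable_const 1) (Filter.Eventually.of_forall fun ω => abs_sin_rpow_le_one hq _)

/-- Large scales: `|sin|^q ≥ sin²`, whose mean is computed by the characteristic function. -/
theorem IsSymmetricStable.lt_sineMoment (hp1 : 1 ≤ p) (hp2 : p ≤ 2)
    (hg : IsSymmetricStable p g P) (hn : ∀ x, 0 ≤ stableDensity p x) {q : ℝ} (hq : 1 ≤ q)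
    (hq2 : q ≤ 2) {a : ℝ} (ha : 1 ≤ a) : 1 / 8 < sineMoment P g q a := by
  rw [hg.sineMoment_eq_integral (by linarith) hn (by linarith)]
  have hi := integrable_stableDensity hp1 hp2
  have hc : Integrable fun x => Real.cos (2 * a * x) * stableDensity p x := by
    refine Integrable.bdd_mul (c := 1) hi (by fun_prop) ?_
    exact Filter.Eventually.of_forall fun x => Real.abs_cos_le_one _
  have h1 : ∫ x, 1 / 2 * (stableDensity p x - Real.cos (2 * a * x) * stableDensity p x)
      = 1 / 2 * (1 - Real.exp (-(|2 * a| ^ p))) := by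
    rw [integral_const_mul, integral_sub hi hc, integral_stableDensity hp1 hp2,
      integral_cos_mul_stableDensity hp1 hp2]
  -- From e^y ≥ 1 + y with y = (2a)^p ≥ 2. The mean of sin² is then at least 1/3, well above 1/8.
  have h2 : Real.exp (-(|2 * a| ^ p)) ≤ 1 / 3 := by
    have h3 : 2 ≤ |2 * a| ^ p := by
      rw [abs_of_pos (by linarith)]
      calc (2 : ℝ) ≤ (2 * a) ^ (1 : ℝ) := by rw [Real.rpow_one]; linarith
        _ ≤ _ := Real.rpow_le_rpow_of_exponent_le (by linarith) hp1
    rw [Real.exp_neg, ← one_div]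
    exact one_div_le_one_div_of_le (by norm_num) (by linarith [Real.add_one_le_exp (|2 * a| ^ p)])
  have h4 : ∫ x, 1 / 2 * (stableDensity p x - Real.cos (2 * a * x) * stableDensity p x)
      ≤ ∫ x, |Real.sin (a * x)| ^ q * stableDensity p x := by
    refine integral_mono ((hi.sub hc).const_mul _) ?_ fun x => ?_
    · simpa using integrableOn_abs_sin_rpow_mul (s := Set.univ) hi.integrableOn
        (by linarith : 0 ≤ q) a
    · have h5 : Real.sin (a * x) ^ 2 ≤ |Real.sin (a * x)| ^ q := by
        rcases (abs_nonneg (Real.sin (a * x))).eq_or_lt with h0 | h0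
        · rw [← sq_abs, ← h0]; simp [Real.rpow_nonneg]
        · rw [← sq_abs, ← Real.rpow_two]
          exact Real.rpow_le_rpow_of_exponent_ge h0 (Real.abs_sin_le_one _) hq2
      have h6 : 1 / 2 * (1 - Real.cos (2 * a * x)) = Real.sin (a * x) ^ 2 := by
        rw [Real.sin_sq_eq_half_sub]; ring_nf
      calc _ = 1 / 2 * (1 - Real.cos (2 * a * x)) * stableDensity p x := by ring
        _ = Real.sin (a * x) ^ 2 * stableDensity p x := by rw [h6]
        _ ≤ _ := mul_le_mul_of_nonneg_right h5 (hn x)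
  rw [h1] at h4
  linarith

end Moments

/-! ### Smoothness for the Cauchy distribution. -/

/-- The relative change is exactly ε (y² - (1+ε)) / ((1+ε)² + y²), and the fraction has absolute
value at most 1. -/
theorem abs_stableDensity_one_scale_sub_le {ε : ℝ} (hε : 0 < ε) (y : ℝ) :
    |(1 + ε)⁻¹ * stableDensity 1 ((1 + ε)⁻¹ * y) - stableDensity 1 y|
      ≤ ε * stableDensity 1 y := by
  rw [stableDensity_one, stableDensity_one]
  have hpi := Real.pi_pos
  have e : (1 + ε)⁻¹ * (1 / Real.pi * (1 / (1 + ((1 + ε)⁻¹ * y) ^ 2)))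
      - 1 / Real.pi * (1 / (1 + y ^ 2))
      = 1 / Real.pi * (1 / (1 + y ^ 2)) * (ε * ((y ^ 2 - (1 + ε)) / ((1 + ε) ^ 2 + y ^ 2))) := by
    have : 1 + ((1 + ε)⁻¹ * y) ^ 2 = ((1 + ε) ^ 2 + y ^ 2) / (1 + ε) ^ 2 := by field_simp
    rw [this]
    field_simp
    ring
  rw [e, abs_mul, abs_of_pos (by positivity), mul_comm ε, abs_mul, abs_of_pos hε]
  have h1 : |(y ^ 2 - (1 + ε)) / ((1 + ε) ^ 2 + y ^ 2)| ≤ 1 := by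
    rw [abs_div, abs_of_pos (show 0 < (1 + ε) ^ 2 + y ^ 2 by positivity),
      div_le_one (by positivity), abs_le]
    constructor <;> nlinarith [sq_nonneg y]
  calc _ ≤ 1 / Real.pi * (1 / (1 + y ^ 2)) * (1 * ε) := by gcongr
    _ = _ := by ring

/-- Smoothness for the Cauchy distribution, by rescaling its density. -/
theorem abs_sinIntegral_stableDensity_one_sub_le {q ε : ℝ} (hq : 0 ≤ q) (hε : 0 < ε) (a : ℝ) :
    |sinIntegral (stableDensity 1) q ((1 + ε) * a) - sinIntegral (stableDensity 1) q a|
      ≤ ε * sinIntegral (stableDensity 1) q a := by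
  have hi : IntegrableOn (stableDensity 1) (Set.Ioi 0) :=
    (integrable_stableDensity le_rfl one_le_two).integrableOn
  have hε1 : 0 < 1 + ε := by linarith
  have hi' : IntegrableOn (fun y => (1 + ε)⁻¹ * stableDensity 1 ((1 + ε)⁻¹ * y)) (Set.Ioi 0) :=
    (((integrable_stableDensity le_rfl one_le_two).comp_mul_left'
      (inv_pos.2 hε1).ne').const_mul _).integrableOn
  -- Substituting y = (1+ε)u moves the dilation from the sine onto the density.
  have e : sinIntegral (stableDensity 1) q ((1 + ε) * a) = ∫ y in Set.Ioi (0 : ℝ),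
      |Real.sin (a * y)| ^ q * ((1 + ε)⁻¹ * stableDensity 1 ((1 + ε)⁻¹ * y)) := by
    have h1 := integral_comp_mul_left_Ioi
      (fun y => |Real.sin (a * y)| ^ q * stableDensity 1 ((1 + ε)⁻¹ * y)) 0 hε1
    rw [mul_zero, smul_eq_mul, ← integral_const_mul] at h1
    unfold sinIntegral
    convert h1 using 1
    · congr 1; ext u
      rw [inv_mul_cancel_left₀ hε1.ne']; ring_nf
    · congr 1; ext u; ring
  have i1 := integrableOn_abs_sin_rpow_mul hi hq a
  rw [e]
  unfold sinIntegral
  rw [← integral_sub (integrableOn_abs_sin_rpow_mul hi' hq a) i1, ← integral_const_mul,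
    ← Real.norm_eq_abs]
  refine norm_integral_le_of_norm_le (i1.const_mul ε) (Filter.Eventually.of_forall fun u => ?_)
  rw [← mul_sub, norm_mul, Real.norm_of_nonneg (Real.rpow_nonneg (abs_nonneg _) _),
    Real.norm_eq_abs]
  calc _ ≤ |Real.sin (a * u)| ^ q * (ε * stableDensity 1 u) := by
        gcongr; exact abs_stableDensity_one_scale_sub_le hε u
    _ = _ := by ring

theorem exists_abs_sinIntegral_stableDensity_sub_le {p : ℝ} (hp1 : 1 ≤ p) (hp2 : p ≤ 2) :
    ∃ C : ℝ, 0 < C ∧ ((∀ x, 0 ≤ stableDensity p x) → ∀ q : ℝ, 1 ≤ q → q ≤ p →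
      ∀ ε : ℝ, 0 < ε → ε < 1 / 2 → ∀ a : ℝ, 0 < a → a ≤ 1 →
      |sinIntegral (stableDensity p) q ((1 + ε) * a) - sinIntegral (stableDensity p) q a|
        ≤ C * ε * sinIntegral (stableDensity p) q a) := by
  rcases hp1.eq_or_lt with rfl | hp
  · refine ⟨1, one_pos, fun _ q hq _ ε hε _ a _ _ => ?_⟩
    rw [one_mul]
    exact abs_sinIntegral_stableDensity_one_sub_le (by linarith) hε a
  · obtain ⟨B, b, r, x₀, H⟩ := exists_densityBounds_stableDensity hp1 hp2
    exact H.exists_abs_sinIntegral_sub_le hp hp2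

/-! ### Assembly of the estimates. -/

theorem lemma3p1 (p : ℝ) (hp1 : 1 ≤ p) (hp2 : p ≤ 2) :
    -- the constants depend on `p` only
    ∃ c C : ℝ, 0 < c ∧ 0 < C ∧
      ∀ (Ω : Type*) [MeasurableSpace Ω] (P : Measure Ω) [IsProbabilityMeasure P] (g : Ω → ℝ),
        IsSymmetricStable p g P →
      ∀ q : ℝ, 1 ≤ q → q ≤ p →
      ∀ ε : ℝ, 0 < ε → ε < 1 / 2 →
        -- threshold
        (∀ a : ℝ, sineMoment P g q a ≤ 1) ∧
        -- finiteness of `Q`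
        (q < p → IntegrableOn (fun u : ℝ => u ^ q * stableDensity p u) (Set.Ioi 0)) ∧
        -- small scales, `q < p`
        (q < p → ∀ a : ℝ, 0 < a →
          a ≤ min (ε ^ (1 / 2 + 1 / (p - q)))
            (Real.sqrt ε * (1 + (p - q) * ε ^ (-(q / 2 + 1))) ^ (-(1 / (p - q)))) →
          1 - C * ε ≤ sineMoment P g q a / (a ^ q * stableQ p q) ∧
            sineMoment P g q a / (a ^ q * stableQ p q) ≤ 1 + C * ε) ∧
        -- small scales, `q = p`
        (q = p → ∀ a : ℝ, 0 < a →
          a ≤ Real.sqrt ε * Real.exp (-(ε ^ (-(q / 2 + 1)))) →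
          1 - C * ε ≤ sineMoment P g q a / (a ^ q * truncatedQ p ε a) ∧
            sineMoment P g q a / (a ^ q * truncatedQ p ε a) ≤ 1 + C * ε) ∧
        -- intermediate scales, `q < p`, with `δ = 1 - a ^ (p - q)`
        (q < p → ∀ a : ℝ, 0 < a → a < 1 →
          c * ((1 + (1 - a ^ (p - q)) * stableQ p q) * a ^ q) ≤ sineMoment P g q a ∧
            sineMoment P g q a ≤ C * ((1 + (1 - a ^ (p - q)) * stableQ p q) * a ^ q)) ∧
        -- intermediate scales, `q = p`
        (q = p → ∀ a : ℝ, 0 < a → a < 1 →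
          (p < 2 → c * ((1 + Real.log (1 / a)) * a ^ q) ≤ sineMoment P g q a) ∧
            sineMoment P g q a ≤ C * ((1 + Real.log (1 / a)) * a ^ q)) ∧
        -- large scales
        (∀ a : ℝ, 1 ≤ a → 1 / 8 < sineMoment P g q a) ∧
        -- smoothness
        (∀ a : ℝ, 0 < a → a ≤ 1 →
          |sineMoment P g q ((1 + ε) * a) - sineMoment P g q a| / sineMoment P g q a ≤ C * ε) := by
  have hp0 : 0 < p := by linarith
  obtain ⟨B, b, r, x₀, H⟩ := exists_densityBounds_stableDensity hp1 hp2
  obtain ⟨C₁, hC₁, hsmall⟩ := H.exists_sinIntegral_small_scale hp1 hp2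
  obtain ⟨C₂, hC₂, hsmall'⟩ := H.exists_sinIntegral_small_scale_self hp1 hp2
  obtain ⟨C₃, hC₃, hupper⟩ := H.exists_sinIntegral_le hp1 hp2
  obtain ⟨C₄, hC₄, hlower⟩ := H.exists_le_sinIntegral hp2
  obtain ⟨C₅, hC₅, hlower'⟩ : ∃ C : ℝ, 0 < C ∧ (p < 2 → (∀ x, 0 ≤ stableDensity p x) →
      ∀ a : ℝ, 0 < a → a < 1 →
        (1 + Real.log (1 / a)) * a ^ p ≤ C * sinIntegral (stableDensity p) p a) := by
    rcases hp2.lt_or_eq with hp | hp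
    · obtain ⟨C, hC, h⟩ := H.exists_le_sinIntegral_self hp1 hp
      exact ⟨C, hC, fun _ => h⟩
    · exact ⟨1, one_pos, fun h => absurd hp h.ne⟩
  obtain ⟨C₆, hC₆, hsmooth⟩ := exists_abs_sinIntegral_stableDensity_sub_le hp1 hp2
  have hB := H.upper_pos
  -- The factors 2C₃ and 4B reflect that H is twice the half-line integral.
  refine ⟨1 / (C₄ + C₅), C₁ + C₂ + 2 * C₃ + 4 * B + C₆, by positivity, by positivity, ?_⟩
  set C := C₁ + C₂ + 2 * C₃ + 4 * B + C₆ with hC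
  intro Ω _ P _ g hg q hq hqp ε hε0 hε1
  have hq0 : 0 ≤ q := by linarith
  have hn := hg.stableDensity_nonneg hp1 hp2
  have hS : ∀ a, sineMoment P g q a = 2 * sinIntegral (stableDensity p) q a :=
    hg.sineMoment_eq hp0 hn hq0
  have hS0 : ∀ a, 0 ≤ sinIntegral (stableDensity p) q a :=
    fun a => DensityBounds.sinIntegral_nonneg hn q a
  refine ⟨fun a => sineMoment_le_one hq0 a, fun hlt => H.integrableOn_rpow_mul hq0 hlt le_rfl,
    fun hlt a ha hamin => ?_, fun heq a ha haT => ?_, fun hlt a ha ha1 => ?_,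
    fun heq a ha ha1 => ?_, fun a ha => hg.lt_sineMoment hp1 hp2 hn hq (by linarith) ha,
    fun a ha ha1 => ?_⟩
  · obtain ⟨h1, h2⟩ := hsmall hn q hq hlt ε hε0 hε1 a ha hamin
    have hr0 := H.radius_pos
    have hb := H.lower_pos
    have hM : 0 < ∫ u in Set.Ioi (0 : ℝ), u ^ q * stableDensity p u :=
      lt_of_lt_of_le (by positivity) (H.le_moment hn hp2 hq0 hlt)
    have hD : 0 < a ^ q * ∫ u in Set.Ioi (0 : ℝ), u ^ q * stableDensity p u :=
      mul_pos (Real.rpow_pos_of_pos ha q) hM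
    have hCC : C₁ * ε ≤ C * ε := by gcongr; linarith
    have e : sineMoment P g q a / (a ^ q * stableQ p q) = sinIntegral (stableDensity p) q a
        / (a ^ q * ∫ u in Set.Ioi (0 : ℝ), u ^ q * stableDensity p u) := by
      rw [hS, stableQ, mul_left_comm, mul_div_mul_left _ _ two_ne_zero]
    rw [e, le_div_iff₀ hD, div_le_iff₀ hD]
    exact ⟨le_trans (by gcongr) h1, h2.trans (by gcongr)⟩
  · subst heq
    obtain ⟨hW, h1, h2⟩ := hsmall' hn ε hε0 hε1 a ha haT
    have hD := mul_pos (Real.rpow_pos_of_pos ha q) hW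
    have hCC : C₂ * ε ≤ C * ε := by gcongr; linarith
    have e : sineMoment P g q a / (a ^ q * truncatedQ q ε a) = sinIntegral (stableDensity q) q a
        / (a ^ q * truncMoment (stableDensity q) q (Real.sqrt ε / a)) := by
      rw [hS, truncatedQ, intervalIntegral.integral_of_le (by positivity), mul_left_comm,
        mul_div_mul_left _ _ two_ne_zero, truncMoment]
    rw [e, le_div_iff₀ hD, div_le_iff₀ hD]
    exact ⟨le_trans (by gcongr) h1, h2.trans (by gcongr)⟩
  · have h1 := hlower hn q hq hlt a ha ha1
    have h2 := hupper hn q hq hlt a ha ha1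
    have haq : 0 < a ^ q := Real.rpow_pos_of_pos ha q
    have hδ : 0 ≤ 1 - a ^ (p - q) := by
      linarith [Real.rpow_le_one ha.le ha1.le (by linarith : 0 ≤ p - q)]
    have hr0 := H.radius_pos
    have hb := H.lower_pos
    have hM : 0 ≤ ∫ u in Set.Ioi (0 : ℝ), u ^ q * stableDensity p u :=
      le_trans (by positivity) (H.le_moment hn hp2 hq0 hlt)
    have hδM := mul_nonneg hδ hM
    rw [hS, stableQ]
    set M := ∫ u in Set.Ioi (0 : ℝ), u ^ q * stableDensity p u
    set δ := 1 - a ^ (p - q)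
    set S := sinIntegral (stableDensity p) q a with hSdef
    have hS0' : 0 ≤ S := hS0 a
    -- Here Q = 2M, so passing from M to Q changes the bracket by at most a factor 2.
    have hle : (1 + δ * M) * a ^ q ≤ (1 + δ * (2 * M)) * a ^ q := by gcongr; linarith
    have hge : (1 + δ * (2 * M)) * a ^ q ≤ 2 * ((1 + δ * M) * a ^ q) := by
      calc _ ≤ 2 * (1 + δ * M) * a ^ q := mul_le_mul_of_nonneg_right (by linarith) haq.le
        _ = _ := by ring
    have hpos : 0 ≤ (1 + δ * (2 * M)) * a ^ q := by positivity
    constructor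
    · rw [one_div_mul_eq_div, div_le_iff₀ (by positivity)]
      linarith [mul_nonneg hC₅.le hS0']
    · calc 2 * S ≤ 2 * (C₃ * ((1 + δ * M) * a ^ q)) := by linarith
        _ ≤ 2 * (C₃ * ((1 + δ * (2 * M)) * a ^ q)) := by gcongr
        _ = 2 * C₃ * ((1 + δ * (2 * M)) * a ^ q) := by ring
        _ ≤ _ := by gcongr; linarith
  · subst heq
    have hl : 0 ≤ Real.log (1 / a) := Real.log_nonneg (by rw [le_div_iff₀ ha]; linarith)
    have haq : 0 < a ^ q := Real.rpow_pos_of_pos ha q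
    have hS0' := hS0 a
    rw [hS]
    constructor
    · intro hlt
      have h1 := hlower' hlt hn a ha ha1
      rw [one_div_mul_eq_div, div_le_iff₀ (by positivity)]
      linarith [mul_nonneg hC₅.le hS0', mul_nonneg hC₄.le hS0']
    · have h2 := H.sinIntegral_self_le hn hp1 ha ha1
      calc _ ≤ 2 * (2 * B * ((1 + Real.log (1 / a)) * a ^ q)) := by gcongr
        _ = 4 * B * ((1 + Real.log (1 / a)) * a ^ q) := by ring
        _ ≤ _ := by gcongr; linarith
  · have hpos := H.sinIntegral_pos hn hp1 hq0 (by linarith) ha ha1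
    rw [hS, hS, ← mul_sub, abs_mul, abs_two, mul_div_mul_left _ _ two_ne_zero, div_le_iff₀ hpos]
    refine (hsmooth hn q hq hqp ε hε0 hε1 a ha ha1).trans ?_
    gcongr
    linarith
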